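/- Let $d\ge1$, let $\Omega\subset\mathbb R^d$ be a bounded open set with Lipschitz boundary, $T>0$, $0<\alpha<1$. Write $\langle\cdot,\cdot\rangle$ for the inner product of $L_2(\Omega)$ or $L_2(\Omega)^d$, $H^1_0(\Omega)$ for the closure of $C_c^\infty(\Omega)$ in $H^1(\Omega)$, $\omega_\mu(t)=t^{\mu-1}/\Gamma(\mu)$ and $\mathcal I^\mu\phi(t)=\int_0^t\omega_\mu(t-s)\phi(s)\,ds$. Assume that - $\kappa\in L_\infty(\Omega)^{d\times d}$ is real, symmetric and uniformly positive definite, that is, for some $c>0$ the minimal eigenvalue of $\kappa(x)$ is at least $c$ for almost every $x\in\Omega$; - $\vec F,\vec G\in C^2([0,T];W^1_\infty(\Omega)^d)$ and $a,b\in C^1([0,T];L_\infty(\Omega))$; - $u_0\in L_2(\Omega)$, and $g:(0,T]\to L_2(\Omega)$ is measurable with $\|g(t)\|\le Mt^{\eta-1}$ for $0<t\le T$ and some constants $M,\eta>0$. Put $f(t)=u_0+\int_0^tg(s)\,ds$ and $$\vec B_1u=B^\alpha_{\vec F}u+B^1_{\vec G}u,\qquad B_2u=B^\alpha_au+B^1_bu,\qquad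 (B^\mu_\psi\phi)(t)=\psi(t)\,\mathcal I^\mu\phi(t)-\int_0^t\psi'(s)\,\mathcal I^\mu\phi(s)\,ds .$$ Consider functions $u:[0,T]\to L_2(\Omega)$ such that $u$ and $\mathcal I^\alpha u$ belong to $L_2((0,T);L_2(\Omega))$, such that $\mathcal I^\alpha u(t)\in H^1_0(\Omega)$ for almost every $t$ with gradient $\mathcal I^\alpha\nabla u:=\nabla\mathcal I^\alpha u\in L_2((0,T);L_2(\Omega)^d)$, and such that for almost every $t\in(0,T)$ $$\langle u(t),v\rangle+\langle\kappa(\mathcal I^\alpha\nabla u)(t),\nabla v\rangle-\langle(\vec B_1u)(t),\nabla v\rangle+\langle(B_2u)(t),v\rangle=\langle f(t),v\rangle\quad\text{for all }v\in H^1_0(\Omega).\tag{$*$}$$ Then there is at most one such function: if $u_1$ and $u_2$ are two of them, then $u_1(t)=u_2(t)$ for almost every $t\in(0,T)$. Moreover, $u_1(t)=u_2(t)$ at every $t\in[0,T]$ at which, for both of them, the integral $\mathcal I^\alpha u_i(t)$ converges in $L_2(\Omega)$ to an element of $H^1_0(\Omega)$ and $(*)$ holds; in particular, if this is so for all $t\in[0,T]$,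 then $u_1=u_2$ on $[0,T]$. -/

import Mathlib

open MeasureTheory Set
open scoped ENNReal ContDiff

noncomputable section

namespace FracPDE

/-- Euclidean space `ℝ^d`. -/
abbrev E (d : ℕ) := EuclideanSpace ℝ (Fin d)

/-- A set whose boundary is locally, in suitable orthogonal coordinates, the graph of a Lipschitz
function with the set lying strictly on one side of it. The unit vector `n` is the direction of the
last coordinate, and `γ`, being invariant along `n`, is a function of the remaining ones. -/
def HasLipschitzBoundary {d : ℕ} (Ω : Set (E d)) : Prop :=
  ∀ x ∈ frontier Ω, ∃ (U : Set (E d)) (n : E d) (γ : E d → ℝ) (K : NNReal),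
    IsOpen U ∧ x ∈ U ∧ ‖n‖ = 1 ∧ LipschitzWith K γ ∧ (∀ y, ∀ c : ℝ, γ (y + c • n) = γ y) ∧
      Ω ∩ U = {y | y ∈ U ∧ γ y < inner ℝ y n}

/-- The space `L_p(Ω; V)` (Lebesgue measure). -/
abbrev LpOn {d : ℕ} (Ω : Set (E d)) (V : Type) [NormedAddCommGroup V] (p : ℝ≥0∞) :=
  Lp V p (volume.restrict Ω)

/-- Test functions: elements of `C_c^∞(Ω)`. -/
def IsTestFunction {d : ℕ} (Ω : Set (E d)) (φ : E d → ℝ) : Prop :=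
  ContDiff ℝ ∞ φ ∧ HasCompactSupport φ ∧ tsupport φ ⊆ Ω

/-- The space `H^1_0(Ω)`, the closure of `C_c^∞(Ω)` in the `H^1` norm; a function `v` in it is
recorded together with its gradient `∇v`, as the pair `(v, ∇v)` in `L_2(Ω) × L_2(Ω)^d`. -/
def H10 {d : ℕ} (Ω : Set (E d)) : Set (LpOn Ω ℝ 2 × LpOn Ω (E d) 2) :=
  closure {w | ∃ φ : E d → ℝ, IsTestFunction Ω φ ∧
    w.1 =ᵐ[volume.restrict Ω] φ ∧ w.2 =ᵐ[volume.restrict Ω] gradient φ}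

/-- `DF` is the weak derivative of the vector field `F` on `Ω`. -/
def HasWeakDeriv {d : ℕ} (Ω : Set (E d)) (F : LpOn Ω (E d) ∞) (DF : LpOn Ω (E d →L[ℝ] E d) ∞) :
    Prop :=
  ∀ φ : E d → ℝ, IsTestFunction Ω φ → ∀ y : E d,
    ∫ x in Ω, (fderiv ℝ φ x y) • F x = - ∫ x in Ω, φ x • DF x y

/-- `F ∈ C^k([0,T]; W^1_∞(Ω)^d)`: both `F` and its weak space derivative are `C^k` functions of
time with values in `L_∞`. -/
def ContDiffW1Inf {d : ℕ} (Ω : Set (E d)) (T : ℝ) (k : ℕ) (F : ℝ → LpOn Ω (E d) ∞) : Prop :=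
  ContDiffOn ℝ k F (Icc 0 T) ∧ ∃ DF : ℝ → LpOn Ω (E d →L[ℝ] E d) ∞,
    ContDiffOn ℝ k DF (Icc 0 T) ∧ ∀ t ∈ Icc 0 T, HasWeakDeriv Ω (F t) (DF t)

/-- The kernel `ω_μ(t) = t^(μ-1) / Γ(μ)`. -/
def omega (μ t : ℝ) : ℝ := t ^ (μ - 1) / Real.Gamma μ

/-- The fractional integral `(I^μ φ)(t) = ∫_0^t ω_μ(t-s) φ(s) ds` (a Bochner integral). -/
def fracInt {V : Type} [NormedAddCommGroup V] [NormedSpace ℝ V] (μ : ℝ) (φ : ℝ → V) (t : ℝ) : V :=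
  ∫ s in 0..t, omega μ (t - s) • φ s

/-- The operator `(B^μ_ψ φ)(t) = ψ(t) (I^μ φ)(t) - ∫_0^t ψ'(s) (I^μ φ)(s) ds` on scalar functions
`φ`, for a coefficient `ψ : [0,T] → L_∞(Ω; V)`. The product of a scalar function and a
`V`-valued one is the pointwise one, `L_2(Ω) × L_∞(Ω; V) → L_2(Ω; V)`. -/
def opB {d : ℕ} {Ω : Set (E d)} {V : Type} [NormedAddCommGroup V] [NormedSpace ℝ V] (T μ : ℝ)
    (ψ : ℝ → LpOn Ω V ∞) (φ : ℝ → LpOn Ω ℝ 2) (t : ℝ) : LpOn Ω V 2 :=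
  ((fracInt μ φ t • ψ t : LpOn Ω V 2)) -
    ∫ s in 0..t, (fracInt μ φ s • derivWithin ψ (Icc 0 T) s : LpOn Ω V 2)

/-- The data of the problem
`∂_t u - ∇·(κ ∇∂_t^{1-α} u - F ∂_t^{1-α} u - G u) + a ∂_t^{1-α} u + b u = g`, `u(0) = u₀`. -/
structure Data {d : ℕ} (Ω : Set (E d)) where
  κ : E d → Matrix (Fin d) (Fin d) ℝ
  F : ℝ → LpOn Ω (E d) ∞
  G : ℝ → LpOn Ω (E d) ∞
  a : ℝ → LpOn Ω ℝ ∞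
  b : ℝ → LpOn Ω ℝ ∞
  g : ℝ → LpOn Ω ℝ 2
  u₀ : LpOn Ω ℝ 2

namespace Data

variable {d : ℕ} {Ω : Set (E d)}

/-- The assumptions on the coefficients and on the source term. -/
structure Admissible (D : Data Ω) (T : ℝ) : Prop where
  kappa_bounded : ∀ i j, MemLp (fun x => D.κ x i j) ∞ (volume.restrict Ω)
  kappa_symm : ∀ᵐ x ∂(volume.restrict Ω), (D.κ x).IsSymm
  kappa_elliptic : ∃ c > 0, ∀ᵐ x ∂(volume.restrict Ω), ∀ ξ : Fin d → ℝ,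
    c * (ξ ⬝ᵥ ξ) ≤ ξ ⬝ᵥ (D.κ x).mulVec ξ
  F_reg : ContDiffW1Inf Ω T 2 D.F
  G_reg : ContDiffW1Inf Ω T 2 D.G
  a_reg : ContDiffOn ℝ 1 D.a (Icc 0 T)
  b_reg : ContDiffOn ℝ 1 D.b (Icc 0 T)
  g_meas : AEStronglyMeasurable D.g (volume.restrict (Ioc 0 T))
  g_bound : ∃ M > 0, ∃ η > 0, ∀ t ∈ Ioc 0 T, ‖D.g t‖ ≤ M * t ^ (η - 1)

/-- The form `⟨κ p, q⟩` for `p, q ∈ L_2(Ω)^d`. -/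
def kappaForm (D : Data Ω) (p q : LpOn Ω (E d) 2) : ℝ :=
  ∫ x in Ω, (D.κ x).mulVec (p x).ofLp ⬝ᵥ (q x).ofLp

/-- `B₁ u`, the integrated-by-parts form of `∫_0^t (F ∂_s^{1-α} u + G u) ds`. -/
def B₁ (D : Data Ω) (T α : ℝ) (u : ℝ → LpOn Ω ℝ 2) (t : ℝ) : LpOn Ω (E d) 2 :=
  opB T α D.F u t + opB T 1 D.G u t

/-- `B₂ u`, the integrated-by-parts form of `∫_0^t (a ∂_s^{1-α} u + b u) ds`. -/
def B₂ (D : Data Ω) (T α : ℝ) (u : ℝ → LpOn Ω ℝ 2) (t : ℝ) : LpOn Ω ℝ 2 :=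
  opB T α D.a u t + opB T 1 D.b u t

/-- `f(t) = u₀ + ∫_0^t g(s) ds`. -/
def f (D : Data Ω) (t : ℝ) : LpOn Ω ℝ 2 := D.u₀ + ∫ s in 0..t, D.g s

/-- The weak formulation at time `t`: the integral `(I^α u)(t)` converges in `L_2(Ω)` to an element
of `H^1_0(Ω)`, whose gradient is `p = (I^α ∇u)(t)`, and for all `v ∈ H^1_0(Ω)`,
`⟨u(t), v⟩ + ⟨κ (I^α ∇u)(t), ∇v⟩ - ⟨(B₁u)(t), ∇v⟩ + ⟨(B₂u)(t), v⟩ = ⟨f(t), v⟩`. -/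
def WeakEqAt (D : Data Ω) (T α : ℝ) (u : ℝ → LpOn Ω ℝ 2) (p : LpOn Ω (E d) 2) (t : ℝ) : Prop :=
  IntervalIntegrable (fun s => omega α (t - s) • u s) volume 0 t ∧
  (fracInt α u t, p) ∈ H10 Ω ∧
  ∀ v ∈ H10 Ω,
    inner ℝ (u t) v.1 + D.kappaForm p v.2 - inner ℝ (D.B₁ T α u t) v.2 + inner ℝ (D.B₂ T α u t) v.1
      = inner ℝ (D.f t) v.1

/-- `u` is a weak solution with `u, I^α u ∈ L_2((0,T); L_2(Ω))` and
`I^α ∇u ∈ L_2((0,T); L_2(Ω)^d)`; the weak formulation is imposed for almost every `t`. -/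
structure IsWeakSolution (D : Data Ω) (T α : ℝ) (u : ℝ → LpOn Ω ℝ 2) : Prop where
  memLp : MemLp u 2 (volume.restrict (Ioo 0 T))
  memLp_fracInt : MemLp (fracInt α u) 2 (volume.restrict (Ioo 0 T))
  weak : ∃ P : ℝ → LpOn Ω (E d) 2, MemLp P 2 (volume.restrict (Ioo 0 T)) ∧
    ∀ᵐ t ∂(volume.restrict (Ioo 0 T)), D.WeakEqAt T α u (P t) t

end Data

end FracPDE

end

/-!
The kernel `ω_α` is a superposition of exponentials: `ω_α(τ) = ∫ e^{-rτ} dμ(r)` on `(0, ∞)`, with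
`dμ = r^{-α} / (Γ(α) Γ(1 - α)) dr`. For one exponential, the convolution `y = e^{-r·} * v` solves
`y' + r y = v`, `y(0) = 0`, so the energy identity gives `∫ ⟨v, y⟩ ≥ r ∫ ‖y‖²`. Integrating in `r`,
the pairing of `u` with `I^α u` controls both `I^α u` and `∫₀ᵗ u` in `L²(0, T)`. In the norm with
weight `e^{-lt}` each `r` becomes `r + l`, and the constants in these bounds tend to `0` as
`l → ∞`.

The difference of two solutions solves the homogeneous problem. Testing it with `I^α u` and
completing the square in the gradient bounds `⟨u, I^α u⟩` by the square of the history of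
`‖I^α u‖` and `‖∫₀ᵗ u‖`, which for large `l` is absorbed by the coercive side. Hence `I^α u` and
`∫₀ᵗ u` vanish, and the equation reduces to `⟨u(t), v⟩ = 0` for all `v ∈ H^1_0(Ω)`, a dense set.
-/

namespace FracPDE

section Primitive

theorem integral_triangle_add {G : Type*} [NormedAddCommGroup G] [NormedSpace ℝ G] {a b : ℝ}
    (hab : a ≤ b) {F : ℝ → ℝ → G} (hF : Integrable (fun p : ℝ × ℝ => F p.1 p.2)
      ((volume.restrict (Ioc a b)).prod (volume.restrict (Ioc a b)))) :
    (∫ x in a..b, ∫ y in a..x, F x y) + ∫ y in a..b, ∫ x in a..y, F x y =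
      ∫ x in a..b, ∫ y in a..b, F x y := by
  set m := volume.restrict (Ioc a b) with hm
  have hS : MeasurableSet {p : ℝ × ℝ | p.2 ≤ p.1} := measurableSet_le measurable_snd measurable_fst
  have lower : ∫ p in {p : ℝ × ℝ | p.2 ≤ p.1}, F p.1 p.2 ∂(m.prod m) =
      ∫ x in a..b, ∫ y in a..x, F x y := by
    rw [← integral_indicator hS, integral_prod _ (hF.indicator hS),
      intervalIntegral.integral_of_le hab]
    refine setIntegral_congr_fun measurableSet_Ioc fun x hx => ?_
    calc ∫ y, {p : ℝ × ℝ | p.2 ≤ p.1}.indicator (fun p => F p.1 p.2) (x, y) ∂m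
        = ∫ y, (Iic x).indicator (F x) y ∂m := rfl
      _ = ∫ y in a..x, F x y := by
        rw [integral_indicator measurableSet_Iic, hm, Measure.restrict_restrict measurableSet_Iic,
          show Iic x ∩ Ioc a b = Ioc a x by grind, intervalIntegral.integral_of_le hx.1.le]
  have upper : ∫ p in {p : ℝ × ℝ | p.2 ≤ p.1}ᶜ, F p.1 p.2 ∂(m.prod m) =
      ∫ y in a..b, ∫ x in a..y, F x y := by
    rw [← integral_indicator hS.compl, integral_prod_symm _ (hF.indicator hS.compl),
      intervalIntegral.integral_of_le hab]
    refine setIntegral_congr_fun measurableSet_Ioc fun y hy => ?_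
    calc ∫ x, {p : ℝ × ℝ | p.2 ≤ p.1}ᶜ.indicator (fun p => F p.1 p.2) (x, y) ∂m
        = ∫ x, (Iio y).indicator (fun x => F x y) x ∂m := by
          simp only [indicator, mem_compl_iff, mem_ofPred_eq, not_le, mem_Iio]
      _ = ∫ x in a..y, F x y := by
        rw [integral_indicator measurableSet_Iio, hm, Measure.restrict_restrict measurableSet_Iio,
          show Iio y ∩ Ioc a b = Ioo a y by grind, intervalIntegral.integral_of_le hy.1.le,
          integral_Ioc_eq_integral_Ioo]
  rw [← lower, ← upper, integral_add_compl hS hF, integral_prod _ hF]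
  simp only [intervalIntegral.integral_of_le hab, ← hm]

theorem integral_clm_primitive_add {E F G : Type*} [NormedAddCommGroup E] [NormedSpace ℝ E]
    [CompleteSpace E] [NormedAddCommGroup F] [NormedSpace ℝ F] [CompleteSpace F]
    [NormedAddCommGroup G] [NormedSpace ℝ G] [CompleteSpace G] (L : E →L[ℝ] F →L[ℝ] G) {a b : ℝ}
    (hab : a ≤ b) {f : ℝ → E} {g : ℝ → F} (hf : IntervalIntegrable f volume a b)
    (hg : IntervalIntegrable g volume a b) :
    (∫ x in a..b, L (f x) (∫ y in a..x, g y)) + ∫ y in a..b, L (∫ x in a..y, f x) (g y) =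
      L (∫ x in a..b, f x) (∫ y in a..b, g y) := by
  have hsub {t : ℝ} (ht : t ∈ uIcc a b) : uIcc a t ⊆ uIcc a b := uIcc_subset_uIcc_left ht
  have hleft (x : ℝ) (hx : x ∈ uIcc a b) :
      ∫ y in a..x, L (f x) (g y) = L (f x) (∫ y in a..x, g y) :=
    (L (f x)).intervalIntegral_comp_comm (hg.mono_set (hsub hx))
  have hright (y : ℝ) (hy : y ∈ uIcc a b) :
      ∫ x in a..y, L (f x) (g y) = L (∫ x in a..y, f x) (g y) :=
    (L.flip (g y)).intervalIntegral_comp_comm (hf.mono_set (hsub hy))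
  have hfull : ∫ x in a..b, ∫ y in a..b, L (f x) (g y) =
      L (∫ x in a..b, f x) (∫ y in a..b, g y) := by
    simp only [fun x => (L (f x)).intervalIntegral_comp_comm hg]
    exact (L.flip (∫ y in a..b, g y)).intervalIntegral_comp_comm hf
  rw [← intervalIntegral.integral_congr hleft, ← intervalIntegral.integral_congr hright, ← hfull]
  exact integral_triangle_add hab
    (hf.1.op_fst_snd (op := fun x y => L x y) (by fun_prop) ⟨‖L‖, L.le_opNorm₂⟩ hg.1)

theorem integral_inner_primitive {H : Type*} [NormedAddCommGroup H] [InnerProductSpace ℝ H]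
    [CompleteSpace H] {a b : ℝ} (hab : a ≤ b) {w : ℝ → H} (hw : IntervalIntegrable w volume a b) :
    2 * ∫ t in a..b, inner ℝ (w t) (∫ s in a..t, w s) = ‖∫ s in a..b, w s‖ ^ 2 := by
  have h := integral_clm_primitive_add (innerSL ℝ) hab hw hw
  simp only [innerSL_apply_apply ℝ] at h
  rw [← real_inner_self_eq_norm_sq, ← h, two_mul]
  simp only [real_inner_comm]

theorem intervalIntegrable_inner_of_continuousOn {H : Type*} [NormedAddCommGroup H]
    [InnerProductSpace ℝ H] {a b : ℝ} {u y : ℝ → H}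
    (hu : IntervalIntegrable u volume a b) (hy : ContinuousOn y (uIcc a b)) :
    IntervalIntegrable (fun t => inner ℝ (u t) (y t)) volume a b := by
  obtain ⟨C, hC⟩ := isCompact_uIcc.exists_bound_of_continuousOn hy
  have hym : AEStronglyMeasurable y (volume.restrict (uIoc a b)) :=
    (hy.mono uIoc_subset_uIcc).aestronglyMeasurable measurableSet_uIoc
  refine (hu.norm.mul_const C).mono_fun (hu.aestronglyMeasurable_restrict_uIoc.inner hym) ?_
  filter_upwards [ae_restrict_mem measurableSet_uIoc] with t ht
  refine (norm_inner_le_norm _ _).trans ((le_abs_self _).trans' ?_)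
  gcongr
  exact hC t (uIoc_subset_uIcc ht)

end Primitive

section ExpConv

variable {H : Type*} [NormedAddCommGroup H] [InnerProductSpace ℝ H] {T : ℝ} {u : ℝ → H}

/-- The solution `y` of `y' + r y = u`, `y(0) = 0`. -/
noncomputable def expConv (r : ℝ) (u : ℝ → H) (t : ℝ) : H :=
  ∫ s in 0..t, Real.exp (-(r * (t - s))) • u s

theorem expConv_eq_exp_smul (r : ℝ) (u : ℝ → H) (t : ℝ) :
    expConv r u t = Real.exp (-(r * t)) • ∫ s in 0..t, Real.exp (r * s) • u s := by
  rw [expConv, ← intervalIntegral.integral_smul]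
  refine intervalIntegral.integral_congr fun s _ => ?_
  simp only [smul_smul, ← Real.exp_add]
  ring_nf

theorem continuousOn_expConv (r : ℝ) (hu : IntervalIntegrable u volume 0 T) :
    ContinuousOn (expConv r u) (uIcc 0 T) := by
  have hU : IntervalIntegrable (fun s => Real.exp (r * s) • u s) volume 0 T :=
    hu.continuousOn_smul (by fun_prop)
  rw [funext (expConv_eq_exp_smul r u)]
  exact (by fun_prop : Continuous fun t => Real.exp (-(r * t))).continuousOn.smul
    (intervalIntegral.continuousOn_primitive_interval' hU left_mem_uIcc)

theorem expConv_eq_primitive [CompleteSpace H] (r : ℝ) (hT : 0 ≤ T)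
    (hu : IntervalIntegrable u volume 0 T) :
    expConv r u T = ∫ s in 0..T, (u s - r • expConv r u s) := by
  have hU : IntervalIntegrable (fun s => Real.exp (r * s) • u s) volume 0 T :=
    hu.continuousOn_smul (by fun_prop)
  have hE : Continuous fun s : ℝ => -r * Real.exp (-(r * s)) := by fun_prop
  have hprim (t : ℝ) : ∫ s in 0..t, -r * Real.exp (-(r * s)) = Real.exp (-(r * t)) - 1 := by
    have hderiv (s : ℝ) : HasDerivAt (fun s => Real.exp (-(r * s))) (-r * Real.exp (-(r * s))) s :=
      ((hasDerivAt_id s).const_mul r).neg.exp.congr_deriv (by simp [mul_comm])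
    rw [intervalIntegral.integral_eq_sub_of_hasDerivAt (fun s _ => hderiv s)
      (hE.intervalIntegrable _ _)]
    simp
  have hparts := integral_clm_primitive_add (ContinuousLinearMap.lsmul ℝ ℝ) hT
    (hE.intervalIntegrable 0 T) hU
  simp only [ContinuousLinearMap.lsmul_apply, hprim] at hparts
  rw [sub_smul, one_smul, ← expConv_eq_exp_smul] at hparts
  have hleft (s : ℝ) : (-r * Real.exp (-(r * s))) • ∫ y in 0..s, Real.exp (r * y) • u y =
      -(r • expConv r u s) := by
    rw [expConv_eq_exp_smul, smul_smul, neg_mul, neg_smul]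
  have hright (s : ℝ) : (Real.exp (-(r * s)) - 1) • Real.exp (r * s) • u s =
      u s - Real.exp (r * s) • u s := by
    rw [smul_smul, sub_mul, ← Real.exp_add, neg_add_cancel, Real.exp_zero, one_mul, sub_smul,
      one_smul]
  simp only [hleft, hright] at hparts
  rw [intervalIntegral.integral_sub hu hU, intervalIntegral.integral_neg] at hparts
  have hy : IntervalIntegrable (fun s => r • expConv r u s) volume 0 T :=
    (continuousOn_expConv r hu).intervalIntegrable.smul r
  rw [intervalIntegral.integral_sub hu hy, ← sub_left_inj, ← hparts]
  abel

theorem integral_sq_le_integral_inner_of_eq_primitive [CompleteSpace H] {l : ℝ} (hT : 0 ≤ T)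
    {y : ℝ → H} (hu : IntervalIntegrable u volume 0 T) (hy : ContinuousOn y (uIcc 0 T))
    (heq : ∀ t ∈ uIcc 0 T, y t = ∫ s in 0..t, (u s - l • y s)) :
    l * ∫ t in 0..T, ‖y t‖ ^ 2 ≤ ∫ t in 0..T, inner ℝ (u t) (y t) := by
  have huy : IntervalIntegrable (fun t => inner ℝ (u t) (y t)) volume 0 T :=
    intervalIntegrable_inner_of_continuousOn hu hy
  have hyy : IntervalIntegrable (fun t => l * ‖y t‖ ^ 2) volume 0 T :=
    (hy.norm.pow 2).intervalIntegrable.const_mul l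
  have hw := integral_inner_primitive hT (hu.sub (hy.intervalIntegrable.smul l))
  have hwy : ∫ t in 0..T, inner ℝ (u t - l • y t) (∫ s in 0..t, (u s - l • y s)) =
      (∫ t in 0..T, inner ℝ (u t) (y t)) - l * ∫ t in 0..T, ‖y t‖ ^ 2 := by
    rw [← intervalIntegral.integral_const_mul, ← intervalIntegral.integral_sub huy hyy]
    refine intervalIntegral.integral_congr fun t ht => ?_
    simp only [← heq t ht, inner_sub_left, real_inner_smul_left, real_inner_self_eq_norm_sq]
  have := sq_nonneg ‖∫ s in 0..T, (u s - l • y s)‖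
  simp only [Pi.smul_apply, hwy] at hw
  linarith

theorem sq_mul_integral_sq_le_of_eq_primitive [CompleteSpace H] {l : ℝ} (hl : 0 < l) (hT : 0 ≤ T)
    {y : ℝ → H} (hu : IntervalIntegrable u volume 0 T)
    (hu2 : IntervalIntegrable (fun t => ‖u t‖ ^ 2) volume 0 T) (hy : ContinuousOn y (uIcc 0 T))
    (heq : ∀ t ∈ uIcc 0 T, y t = ∫ s in 0..t, (u s - l • y s)) :
    l ^ 2 * ∫ t in 0..T, ‖y t‖ ^ 2 ≤ ∫ t in 0..T, ‖u t‖ ^ 2 := by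
  have henergy := integral_sq_le_integral_inner_of_eq_primitive hT hu hy heq
  have hy2 : IntervalIntegrable (fun t => l ^ 2 * ‖y t‖ ^ 2) volume 0 T :=
    (hy.norm.pow 2).intervalIntegrable.const_mul (l ^ 2)
  have hyoung : ∫ t in 0..T, 2 * l * inner ℝ (u t) (y t) ≤
      ∫ t in 0..T, (‖u t‖ ^ 2 + l ^ 2 * ‖y t‖ ^ 2) := by
    refine intervalIntegral.integral_mono_on hT
      ((intervalIntegrable_inner_of_continuousOn hu hy).const_mul _) (hu2.add hy2) fun t _ => ?_
    have h := real_inner_self_nonneg (x := u t - l • y t)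
    rw [real_inner_self_eq_norm_sq, norm_sub_sq_real, real_inner_smul_right, norm_smul, mul_pow,
      Real.norm_eq_abs, sq_abs] at h
    linarith
  rw [intervalIntegral.integral_add hu2 hy2, intervalIntegral.integral_const_mul,
    intervalIntegral.integral_const_mul] at hyoung
  linarith [mul_le_mul_of_nonneg_left henergy hl.le]

theorem integral_sq_expConv_le_integral_inner [CompleteSpace H] (r : ℝ) (hT : 0 ≤ T)
    (hu : IntervalIntegrable u volume 0 T) :
    r * ∫ t in 0..T, ‖expConv r u t‖ ^ 2 ≤ ∫ t in 0..T, inner ℝ (u t) (expConv r u t) :=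
  integral_sq_le_integral_inner_of_eq_primitive hT hu (continuousOn_expConv r hu) fun t ht =>
    expConv_eq_primitive r (by simpa [hT] using ht.1) (hu.mono_set (uIcc_subset_uIcc_left ht))

theorem sq_mul_integral_sq_expConv_le [CompleteSpace H] {r : ℝ} (hr : 0 < r) (hT : 0 ≤ T)
    (hu : IntervalIntegrable u volume 0 T)
    (hu2 : IntervalIntegrable (fun t => ‖u t‖ ^ 2) volume 0 T) :
    r ^ 2 * ∫ t in 0..T, ‖expConv r u t‖ ^ 2 ≤ ∫ t in 0..T, ‖u t‖ ^ 2 :=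
  sq_mul_integral_sq_le_of_eq_primitive hr hT hu hu2 (continuousOn_expConv r hu) fun t ht =>
    expConv_eq_primitive r (by simpa [hT] using ht.1) (hu.mono_set (uIcc_subset_uIcc_left ht))

theorem expConv_sub_expConv_add [CompleteSpace H] (l r : ℝ) (hT : 0 ≤ T)
    (hu : IntervalIntegrable u volume 0 T) :
    expConv l u T - expConv (l + r) u T = ∫ s in 0..T,
      (r • expConv (l + r) u s - l • (expConv l u s - expConv (l + r) u s)) := by
  have hy (q : ℝ) : IntervalIntegrable (fun s => q • expConv q u s) volume 0 T :=
    (continuousOn_expConv q hu).intervalIntegrable.smul q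
  rw [expConv_eq_primitive l hT hu, expConv_eq_primitive (l + r) hT hu,
    ← intervalIntegral.integral_sub (hu.sub (hy l)) (hu.sub (hy (l + r)))]
  refine intervalIntegral.integral_congr fun s _ => ?_
  module

-- `z = expConv l u - expConv (l + r) u` solves `z' + l z = r • expConv (l + r) u`.
theorem integral_sq_expConv_le_add [CompleteSpace H] {l : ℝ} (hl : 0 < l) (r : ℝ) (hT : 0 ≤ T)
    (hu : IntervalIntegrable u volume 0 T) :
    ∫ t in 0..T, ‖expConv l u t‖ ^ 2 ≤
      2 * (1 + (r / l) ^ 2) * ∫ t in 0..T, ‖expConv (l + r) u t‖ ^ 2 := by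
  set y : ℝ → H := expConv (l + r) u
  set z : ℝ → H := fun t => expConv l u t - y t
  have hx : ContinuousOn (expConv l u) (uIcc 0 T) := continuousOn_expConv l hu
  have hy : ContinuousOn y (uIcc 0 T) := continuousOn_expConv (l + r) hu
  have hz : ContinuousOn z (uIcc 0 T) := hx.sub hy
  have hry : ContinuousOn (fun t => r • y t) (uIcc 0 T) := hy.const_smul r
  have hdiff : l ^ 2 * ∫ t in 0..T, ‖z t‖ ^ 2 ≤ r ^ 2 * ∫ t in 0..T, ‖y t‖ ^ 2 := by
    have h := sq_mul_integral_sq_le_of_eq_primitive hl hT hry.intervalIntegrable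
      (hry.norm.pow 2).intervalIntegrable hz fun t ht => expConv_sub_expConv_add l r
        (by simpa [hT] using ht.1) (hu.mono_set (uIcc_subset_uIcc_left ht))
    simpa only [norm_smul, mul_pow, Real.norm_eq_abs, sq_abs,
      intervalIntegral.integral_const_mul] using h
  have hsq (t : ℝ) : ‖expConv l u t‖ ^ 2 ≤ 2 * (‖z t‖ ^ 2 + ‖y t‖ ^ 2) :=
    (pow_le_pow_left₀ (norm_nonneg _) (norm_le_norm_sub_add _ (y t)) 2).trans add_sq_le
  have hzi : IntervalIntegrable (fun t => ‖z t‖ ^ 2) volume 0 T :=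
    (hz.norm.pow 2).intervalIntegrable
  have hyi : IntervalIntegrable (fun t => ‖y t‖ ^ 2) volume 0 T :=
    (hy.norm.pow 2).intervalIntegrable
  calc ∫ t in 0..T, ‖expConv l u t‖ ^ 2
      ≤ ∫ t in 0..T, 2 * (‖z t‖ ^ 2 + ‖y t‖ ^ 2) :=
        intervalIntegral.integral_mono_on hT (hx.norm.pow 2).intervalIntegrable
          ((hzi.add hyi).const_mul 2) fun t _ => hsq t
    _ = 2 * ((∫ t in 0..T, ‖z t‖ ^ 2) + ∫ t in 0..T, ‖y t‖ ^ 2) := by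
        rw [intervalIntegral.integral_const_mul, intervalIntegral.integral_add hzi hyi]
    _ ≤ 2 * (r ^ 2 * (∫ t in 0..T, ‖y t‖ ^ 2) / l ^ 2 + ∫ t in 0..T, ‖y t‖ ^ 2) := by
        gcongr
        exact (le_div_iff₀' (by positivity)).2 hdiff
    _ = 2 * (1 + (r / l) ^ 2) * ∫ t in 0..T, ‖y t‖ ^ 2 := by ring

theorem mul_integral_sq_expConv_le_add [CompleteSpace H] {l r : ℝ} (hl : 0 < l) (hr : 0 ≤ r)
    (hrl : r ≤ l) (hT : 0 ≤ T) (hu : IntervalIntegrable u volume 0 T) :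
    l * ∫ t in 0..T, ‖expConv l u t‖ ^ 2 ≤
      4 * ((l + r) * ∫ t in 0..T, ‖expConv (l + r) u t‖ ^ 2) := by
  have hN (q : ℝ) : 0 ≤ ∫ t in 0..T, ‖expConv q u t‖ ^ 2 :=
    intervalIntegral.integral_nonneg hT fun t _ => sq_nonneg _
  have hratio : r / l ≤ 1 := (div_le_one hl).2 hrl
  calc l * ∫ t in 0..T, ‖expConv l u t‖ ^ 2
      ≤ (l + r) * (2 * (1 + (r / l) ^ 2) * ∫ t in 0..T, ‖expConv (l + r) u t‖ ^ 2) :=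
        mul_le_mul (le_add_of_nonneg_right hr) (integral_sq_expConv_le_add hl r hT hu) (hN l)
          (add_nonneg hl.le hr)
    _ ≤ (l + r) * (2 * (1 + 1 ^ 2) * ∫ t in 0..T, ‖expConv (l + r) u t‖ ^ 2) := by
        gcongr
        exact hN _
    _ = 4 * ((l + r) * ∫ t in 0..T, ‖expConv (l + r) u t‖ ^ 2) := by ring

end ExpConv

section Superposition

variable {H : Type*} [NormedAddCommGroup H] [InnerProductSpace ℝ H] {X : Type*}
  [MeasurableSpace X] {ν : Measure X} {ρ : X → ℝ} {T : ℝ} {v : ℝ → H}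

theorem mul_le_sq_mul_inv_add_mul_sq {r : ℝ} (hr : 0 < r) (a b : ℝ) :
    a * b ≤ a ^ 2 * r⁻¹ + r * b ^ 2 := by
  have hsum : 0 ≤ a ^ 2 * r⁻¹ + r * b ^ 2 := by positivity
  have hsquare : 0 ≤ r * (b - a * r⁻¹) ^ 2 := by positivity
  have hexpand : r * (b - a * r⁻¹) ^ 2 = a ^ 2 * r⁻¹ + r * b ^ 2 - 2 * (a * b) := by
    field_simp; ring
  linarith

theorem sq_integral_le_integral_inv_mul (hρ : ∀ᵐ x ∂ν, 0 < ρ x)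
    (hρi : Integrable (fun x => (ρ x)⁻¹) ν) {g : X → ℝ} (hg : Integrable g ν)
    (hg2 : Integrable (fun x => ρ x * g x ^ 2) ν) :
    (∫ x, g x ∂ν) ^ 2 ≤ (∫ x, (ρ x)⁻¹ ∂ν) * ∫ x, ρ x * g x ^ 2 ∂ν := by
  have hquad (y : ℝ) : 0 ≤ (∫ x, (ρ x)⁻¹ ∂ν) * (y * y) + (-(2 * ∫ x, g x ∂ν)) * y +
      ∫ x, ρ x * g x ^ 2 ∂ν := by
    have hint : 0 ≤ ∫ x, ((ρ x)⁻¹ * (y * y) + (-(2 * y)) * g x + ρ x * g x ^ 2) ∂ν := by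
      refine integral_nonneg_of_ae ?_
      filter_upwards [hρ] with x hx
      have hsq : (ρ x)⁻¹ * (y * y) + (-(2 * y)) * g x + ρ x * g x ^ 2 =
          ρ x * (g x - y * (ρ x)⁻¹) ^ 2 := by field_simp; ring
      simp only [Pi.zero_apply, hsq]
      positivity
    have hlin : Integrable (fun x => (ρ x)⁻¹ * (y * y) + (-(2 * y)) * g x) ν :=
      (hρi.mul_const _).add (hg.const_mul _)
    rw [integral_add hlin hg2, integral_add (hρi.mul_const _) (hg.const_mul _), integral_mul_const,
      integral_const_mul] at hint
    linarith
  have hdiscrim := discrim_le_zero hquad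
  rw [discrim] at hdiscrim
  linarith

theorem aestronglyMeasurable_expConv [SFinite ν] (hρm : Measurable ρ)
    (hv : AEStronglyMeasurable v (volume.restrict (Ioc 0 T))) :
    AEStronglyMeasurable (fun p : ℝ × X => expConv (ρ p.2) v p.1)
      ((volume.restrict (Ioc 0 T)).prod ν) := by
  set m := volume.restrict (Ioc (0 : ℝ) T) with hm
  have hkernel : Measurable fun q : (ℝ × X) × ℝ => {q : (ℝ × X) × ℝ | q.2 ≤ q.1.1}.indicator
      (fun q => Real.exp (-(ρ q.1.2 * (q.1.1 - q.2)))) q :=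
    Measurable.indicator (by fun_prop)
      (measurableSet_le measurable_snd (measurable_fst.comp measurable_fst))
  refine ((hkernel.aestronglyMeasurable (μ := (m.prod ν).prod m)).smul
    hv.comp_snd).integral_prod_right'.congr ?_
  have hmem : ∀ᵐ p ∂(m.prod ν), p.1 ∈ Ioc 0 T :=
    Measure.quasiMeasurePreserving_fst.ae (ae_restrict_mem measurableSet_Ioc)
  filter_upwards [hmem] with p hp
  calc ∫ s, {q : (ℝ × X) × ℝ | q.2 ≤ q.1.1}.indicator
        (fun q => Real.exp (-(ρ q.1.2 * (q.1.1 - q.2)))) (p, s) • v s ∂m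
      = ∫ s, (Iic p.1).indicator (fun s => Real.exp (-(ρ p.2 * (p.1 - s))) • v s) s ∂m := by
        simp only [indicator_smul_apply_left]
        rfl
    _ = expConv (ρ p.2) v p.1 := by
        rw [integral_indicator measurableSet_Iic, hm, Measure.restrict_restrict measurableSet_Iic,
          show Iic p.1 ∩ Ioc 0 T = Ioc 0 p.1 by grind, expConv,
          intervalIntegral.integral_of_le hp.1.le]

variable [CompleteSpace H]

theorem integrable_mul_sq_expConv [SFinite ν] (hρm : Measurable ρ) (hρ : ∀ᵐ x ∂ν, 0 < ρ x)
    (hρi : Integrable (fun x => (ρ x)⁻¹) ν) (hT : 0 ≤ T)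
    (hv : MemLp v 2 (volume.restrict (Ioc 0 T))) :
    Integrable (fun p : ℝ × X => ρ p.2 * ‖expConv (ρ p.2) v p.1‖ ^ 2)
      ((volume.restrict (Ioc 0 T)).prod ν) := by
  have hvi : IntervalIntegrable v volume 0 T :=
    (intervalIntegrable_iff_integrableOn_Ioc_of_le hT).2 (hv.integrable one_le_two)
  have hv2 : IntervalIntegrable (fun t => ‖v t‖ ^ 2) volume 0 T :=
    (intervalIntegrable_iff_integrableOn_Ioc_of_le hT).2 hv.norm.integrable_sq
  have hmeas : AEStronglyMeasurable (fun p : ℝ × X => ρ p.2 * ‖expConv (ρ p.2) v p.1‖ ^ 2)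
      ((volume.restrict (Ioc 0 T)).prod ν) :=
    (by fun_prop : Measurable fun p : ℝ × X => ρ p.2).aestronglyMeasurable.mul
      ((aestronglyMeasurable_expConv hρm hv.1).norm.pow 2)
  refine (integrable_prod_iff' hmeas).2 ⟨.of_forall fun x => ?_, ?_⟩
  · exact (((continuousOn_expConv (ρ x) hvi).norm.pow 2).const_mul (ρ x)).intervalIntegrable.1
  · refine (hρi.mul_const (∫ t in 0..T, ‖v t‖ ^ 2)).mono'
      hmeas.norm.prod_swap.integral_prod_right' ?_
    filter_upwards [hρ] with x hx
    have henergy := sq_mul_integral_sq_expConv_le hx hT hvi hv2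
    rw [Real.norm_of_nonneg (integral_nonneg fun t => norm_nonneg _)]
    calc ∫ t in Ioc 0 T, ‖ρ x * ‖expConv (ρ x) v t‖ ^ 2‖
        = ρ x * ∫ t in 0..T, ‖expConv (ρ x) v t‖ ^ 2 := by
          simp only [norm_mul, norm_pow, norm_norm, Real.norm_of_nonneg hx.le, integral_const_mul,
            intervalIntegral.integral_of_le hT]
      _ = (ρ x)⁻¹ * (ρ x ^ 2 * ∫ t in 0..T, ‖expConv (ρ x) v t‖ ^ 2) := by field_simp
      _ ≤ (ρ x)⁻¹ * ∫ t in 0..T, ‖v t‖ ^ 2 := by gcongr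

theorem integrable_mul_integral_sq_expConv [SFinite ν] (hρm : Measurable ρ)
    (hρ : ∀ᵐ x ∂ν, 0 < ρ x) (hρi : Integrable (fun x => (ρ x)⁻¹) ν) (hT : 0 ≤ T)
    (hv : MemLp v 2 (volume.restrict (Ioc 0 T))) :
    Integrable (fun x => ρ x * ∫ t in 0..T, ‖expConv (ρ x) v t‖ ^ 2) ν := by
  simpa only [integral_const_mul, intervalIntegral.integral_of_le hT] using
    (integrable_mul_sq_expConv hρm hρ hρi hT hv).integral_prod_right

theorem integrable_expConv_prod [SFinite ν] (hρm : Measurable ρ) (hρ : ∀ᵐ x ∂ν, 0 < ρ x)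
    (hρi : Integrable (fun x => (ρ x)⁻¹) ν) (hT : 0 ≤ T)
    (hv : MemLp v 2 (volume.restrict (Ioc 0 T))) :
    Integrable (fun p : ℝ × X => expConv (ρ p.2) v p.1) ((volume.restrict (Ioc 0 T)).prod ν) := by
  refine (((integrable_const (1 : ℝ)).mul_prod hρi).add
    (integrable_mul_sq_expConv hρm hρ hρi hT hv)).mono' (aestronglyMeasurable_expConv hρm hv.1) ?_
  filter_upwards [Measure.quasiMeasurePreserving_snd.ae hρ] with p hp
  simpa using mul_le_sq_mul_inv_add_mul_sq hp 1 ‖expConv (ρ p.2) v p.1‖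

theorem integrable_inner_expConv_prod [SFinite ν] (hρm : Measurable ρ) (hρ : ∀ᵐ x ∂ν, 0 < ρ x)
    (hρi : Integrable (fun x => (ρ x)⁻¹) ν) (hT : 0 ≤ T)
    (hv : MemLp v 2 (volume.restrict (Ioc 0 T))) :
    Integrable (fun p : ℝ × X => inner ℝ (v p.1) (expConv (ρ p.2) v p.1))
      ((volume.restrict (Ioc 0 T)).prod ν) := by
  refine ((hv.norm.integrable_sq.mul_prod hρi).add
    (integrable_mul_sq_expConv hρm hρ hρi hT hv)).mono'
    (hv.1.comp_fst.inner (aestronglyMeasurable_expConv hρm hv.1)) ?_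
  filter_upwards [Measure.quasiMeasurePreserving_snd.ae hρ] with p hp
  exact (norm_inner_le_norm _ _).trans (mul_le_sq_mul_inv_add_mul_sq hp _ _)

theorem integral_mul_integral_sq_expConv_le [SFinite ν] (hρm : Measurable ρ)
    (hρ : ∀ᵐ x ∂ν, 0 < ρ x) (hρi : Integrable (fun x => (ρ x)⁻¹) ν) (hT : 0 ≤ T)
    (hv : MemLp v 2 (volume.restrict (Ioc 0 T))) :
    ∫ x, (ρ x * ∫ t in 0..T, ‖expConv (ρ x) v t‖ ^ 2) ∂ν ≤
      ∫ t in 0..T, inner ℝ (v t) (∫ x, expConv (ρ x) v t ∂ν) := by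
  have hvi : IntervalIntegrable v volume 0 T :=
    (intervalIntegrable_iff_integrableOn_Ioc_of_le hT).2 (hv.integrable one_le_two)
  have hinner := integrable_inner_expConv_prod hρm hρ hρi hT hv
  have hsq := integrable_mul_integral_sq_expConv hρm hρ hρi hT hv
  calc ∫ x, (ρ x * ∫ t in 0..T, ‖expConv (ρ x) v t‖ ^ 2) ∂ν
      ≤ ∫ x, (∫ t in Ioc 0 T, inner ℝ (v t) (expConv (ρ x) v t)) ∂ν :=
        integral_mono hsq hinner.integral_prod_right fun x => by
          simpa only [intervalIntegral.integral_of_le hT] using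
            integral_sq_expConv_le_integral_inner (ρ x) hT hvi
    _ = ∫ t in Ioc 0 T, ∫ x, inner ℝ (v t) (expConv (ρ x) v t) ∂ν :=
        (integral_integral_swap hinner).symm
    _ = ∫ t in 0..T, inner ℝ (v t) (∫ x, expConv (ρ x) v t ∂ν) := by
        rw [intervalIntegral.integral_of_le hT]
        refine integral_congr_ae ?_
        filter_upwards [(integrable_expConv_prod hρm hρ hρi hT hv).prod_right_ae] with t ht
        exact integral_inner ht (v t)

theorem memLp_integral_expConv [SFinite ν] (hρm : Measurable ρ)
    (hρ : ∀ᵐ x ∂ν, 0 < ρ x) (hρi : Integrable (fun x => (ρ x)⁻¹) ν) (hT : 0 ≤ T)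
    (hv : MemLp v 2 (volume.restrict (Ioc 0 T))) :
    MemLp (fun t => ∫ x, expConv (ρ x) v t ∂ν) 2 (volume.restrict (Ioc 0 T)) ∧
    ∫ t in 0..T, ‖∫ x, expConv (ρ x) v t ∂ν‖ ^ 2 ≤
      (∫ x, (ρ x)⁻¹ ∂ν) * ∫ x, (ρ x * ∫ t in 0..T, ‖expConv (ρ x) v t‖ ^ 2) ∂ν := by
  have hint := integrable_expConv_prod hρm hρ hρi hT hv
  have hsq := integrable_mul_sq_expConv hρm hρ hρi hT hv
  have hbound : ∀ᵐ t ∂(volume.restrict (Ioc 0 T)), ‖∫ x, expConv (ρ x) v t ∂ν‖ ^ 2 ≤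
      (∫ x, (ρ x)⁻¹ ∂ν) * ∫ x, ρ x * ‖expConv (ρ x) v t‖ ^ 2 ∂ν := by
    filter_upwards [hint.prod_right_ae, hsq.prod_right_ae] with t ht ht2
    calc ‖∫ x, expConv (ρ x) v t ∂ν‖ ^ 2 ≤ (∫ x, ‖expConv (ρ x) v t‖ ∂ν) ^ 2 := by
          gcongr
          exact norm_integral_le_integral_norm _
      _ ≤ _ := sq_integral_le_integral_inv_mul hρ hρi ht.norm ht2
  have hmaj := hsq.integral_prod_left.const_mul (∫ x, (ρ x)⁻¹ ∂ν)
  have hmeas : AEStronglyMeasurable (fun t => ∫ x, expConv (ρ x) v t ∂ν)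
      (volume.restrict (Ioc 0 T)) := hint.1.integral_prod_right'
  have hW : Integrable (fun t => ‖∫ x, expConv (ρ x) v t ∂ν‖ ^ 2) (volume.restrict (Ioc 0 T)) :=
    hmaj.mono' (hmeas.norm.pow 2) (hbound.mono fun t ht => by
      rwa [Real.norm_of_nonneg (by positivity)])
  refine ⟨(memLp_two_iff_integrable_sq_norm hmeas).2 hW, ?_⟩
  rw [intervalIntegral.integral_of_le hT]
  refine (integral_mono_ae hW hmaj hbound).trans_eq ?_
  rw [integral_const_mul, integral_integral_swap hsq]
  simp only [integral_const_mul, intervalIntegral.integral_of_le hT]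

end Superposition

section Tilt

variable {H : Type*} [NormedAddCommGroup H] [InnerProductSpace ℝ H]

/-- The function `t ↦ e^{-lt} f(t)`: the norm of `expTilt l f` in `L_2(0,T)` is an exponentially
weighted norm of `f`. -/
noncomputable def expTilt (l : ℝ) (f : ℝ → H) (t : ℝ) : H :=
  Real.exp (-(l * t)) • f t

theorem expTilt_neg_expTilt (l : ℝ) (f : ℝ → H) : expTilt (-l) (expTilt l f) = f := by
  ext t
  simp [expTilt, smul_smul, ← Real.exp_add]

theorem norm_expTilt (l : ℝ) (f : ℝ → H) (t : ℝ) :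
    ‖expTilt l f t‖ = expTilt l (fun s => ‖f s‖) t := by
  simp [expTilt, norm_smul]

theorem memLp_expTilt (l : ℝ) {T : ℝ} {f : ℝ → H} (hf : MemLp f 2 (volume.restrict (Ioc 0 T))) :
    MemLp (expTilt l f) 2 (volume.restrict (Ioc 0 T)) := by
  have hE : Continuous fun t => Real.exp (-(l * t)) := by fun_prop
  refine hf.of_le_mul (c := Real.exp (|l| * T)) (hE.aestronglyMeasurable.smul hf.1) ?_
  filter_upwards [ae_restrict_mem measurableSet_Ioc] with t ht
  rw [expTilt, norm_smul, Real.norm_eq_abs, Real.abs_exp]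
  gcongr
  calc -(l * t) ≤ |l * t| := neg_le_abs _
    _ = |l| * t := by rw [abs_mul, abs_of_pos ht.1]
    _ ≤ |l| * T := by gcongr; exact ht.2

theorem expTilt_expConv (l r : ℝ) (u : ℝ → H) (t : ℝ) :
    expTilt l (expConv r u) t = expConv (r + l) (expTilt l u) t := by
  rw [expTilt, expConv, expConv, ← intervalIntegral.integral_smul]
  refine intervalIntegral.integral_congr fun s _ => ?_
  simp only [expTilt, smul_smul, ← Real.exp_add]
  ring_nf

theorem expTilt_primitive (l : ℝ) (u : ℝ → H) (t : ℝ) :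
    expTilt l (fun t => ∫ s in 0..t, u s) t = expConv l (expTilt l u) t := by
  have h := expTilt_expConv l 0 u t
  rw [zero_add] at h
  rw [← h]
  simp [expTilt, expConv]

end Tilt

section Kernel

/-- The measure on `(0,∞)` whose Laplace transform is the kernel `ω_α`, for `0 < α < 1`. -/
noncomputable def kernelMeasure (α : ℝ) : Measure ℝ :=
  (volume.restrict (Ioi 0)).withDensity
    fun r => ENNReal.ofReal (r ^ (-α) / (Real.Gamma α * Real.Gamma (1 - α)))

noncomputable instance (α : ℝ) : SFinite (kernelMeasure α) := by
  unfold kernelMeasure; infer_instance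

variable {α : ℝ}

theorem omega_pos {μ τ : ℝ} (hμ : 0 < μ) (hτ : 0 < τ) : 0 < omega μ τ :=
  div_pos (Real.rpow_pos_of_pos hτ _) (Real.Gamma_pos_of_pos hμ)

theorem intervalIntegrable_omega {μ : ℝ} (hμ : 0 < μ) (T : ℝ) :
    IntervalIntegrable (omega μ) volume 0 T :=
  (intervalIntegral.intervalIntegrable_rpow' (by linarith)).div_const _

theorem Gamma_mul_Gamma_one_sub_pos (hα : α ∈ Ioo (0 : ℝ) 1) :
    0 < Real.Gamma α * Real.Gamma (1 - α) :=
  mul_pos (Real.Gamma_pos_of_pos hα.1) (Real.Gamma_pos_of_pos (sub_pos.2 hα.2))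

theorem kernelDensity_pos (hα : α ∈ Ioo (0 : ℝ) 1) {r : ℝ} (hr : 0 < r) :
    0 < r ^ (-α) / (Real.Gamma α * Real.Gamma (1 - α)) :=
  div_pos (Real.rpow_pos_of_pos hr _) (Gamma_mul_Gamma_one_sub_pos hα)

theorem measurable_kernelDensity (α : ℝ) :
    Measurable fun r : ℝ => ENNReal.ofReal (r ^ (-α) / (Real.Gamma α * Real.Gamma (1 - α))) := by
  fun_prop

theorem integrable_kernelMeasure_iff (hα : α ∈ Ioo (0 : ℝ) 1) {g : ℝ → ℝ} :
    Integrable g (kernelMeasure α) ↔ IntegrableOn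
      (fun r => r ^ (-α) / (Real.Gamma α * Real.Gamma (1 - α)) * g r) (Ioi 0) := by
  rw [kernelMeasure, integrable_withDensity_iff_integrable_smul' (measurable_kernelDensity α)
    (by simp), IntegrableOn]
  refine integrable_congr ?_
  filter_upwards [ae_restrict_mem measurableSet_Ioi] with r hr
  rw [ENNReal.toReal_ofReal (kernelDensity_pos hα hr).le, smul_eq_mul]

theorem integral_kernelMeasure (hα : α ∈ Ioo (0 : ℝ) 1) (g : ℝ → ℝ) :
    ∫ r, g r ∂(kernelMeasure α) =
      ∫ r in Ioi 0, r ^ (-α) / (Real.Gamma α * Real.Gamma (1 - α)) * g r := by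
  rw [kernelMeasure, integral_withDensity_eq_integral_toReal_smul (measurable_kernelDensity α)
    (by simp)]
  refine setIntegral_congr_fun measurableSet_Ioi fun r hr => ?_
  rw [ENNReal.toReal_ofReal (kernelDensity_pos hα hr).le, smul_eq_mul]

theorem ae_pos_kernelMeasure (α : ℝ) : ∀ᵐ r ∂(kernelMeasure α), 0 < r :=
  (withDensity_absolutelyContinuous _ _).ae_le (ae_restrict_mem measurableSet_Ioi)

theorem integral_exp_kernelMeasure (hα : α ∈ Ioo (0 : ℝ) 1) {τ : ℝ} (hτ : 0 < τ) :
    ∫ r, Real.exp (-(r * τ)) ∂(kernelMeasure α) = omega α τ := by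
  have hα' := Real.Gamma_pos_of_pos hα.1
  have hα'' := Real.Gamma_pos_of_pos (sub_pos.2 hα.2)
  calc ∫ r, Real.exp (-(r * τ)) ∂(kernelMeasure α)
      = ∫ r in Ioi 0, (Real.Gamma α * Real.Gamma (1 - α))⁻¹ *
          (r ^ (1 - α - 1) * Real.exp (-(τ * r))) := by
        rw [integral_kernelMeasure hα]
        refine setIntegral_congr_fun measurableSet_Ioi fun r _ => ?_
        simp only [sub_sub_cancel_left, mul_comm τ]
        ring
    _ = (Real.Gamma α * Real.Gamma (1 - α))⁻¹ * ((1 / τ) ^ (1 - α) * Real.Gamma (1 - α)) := by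
        rw [integral_const_mul, Real.integral_rpow_mul_exp_neg_mul_Ioi (sub_pos.2 hα.2) hτ]
    _ = omega α τ := by
        rw [omega, one_div, Real.inv_rpow hτ.le, ← Real.rpow_neg hτ.le, neg_sub]
        field_simp

theorem integrable_exp_kernelMeasure (hα : α ∈ Ioo (0 : ℝ) 1) {τ : ℝ} (hτ : 0 < τ) :
    Integrable (fun r => Real.exp (-(r * τ))) (kernelMeasure α) :=
  .of_integral_ne_zero (by rw [integral_exp_kernelMeasure hα hτ]; exact (omega_pos hα.1 hτ).ne')

theorem integrable_inv_add_one_kernelMeasure (hα : α ∈ Ioo (0 : ℝ) 1) :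
    Integrable (fun r => (r + 1)⁻¹) (kernelMeasure α) := by
  rw [integrable_kernelMeasure_iff hα, ← Ioc_union_Ioi_eq_Ioi (zero_le_one (α := ℝ))]
  have hΓ := Gamma_mul_Gamma_one_sub_pos hα
  have hmeas : Measurable fun r : ℝ =>
      r ^ (-α) / (Real.Gamma α * Real.Gamma (1 - α)) * (r + 1)⁻¹ := by fun_prop
  have near_zero : IntegrableOn (fun r : ℝ => r ^ (-α) / (Real.Gamma α * Real.Gamma (1 - α)))
      (Ioc 0 1) :=
    (intervalIntegral.intervalIntegrable_rpow' (by linarith [hα.2])).1.div_const _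
  have near_infty : IntegrableOn (fun r : ℝ => r ^ (-α - 1) / (Real.Gamma α * Real.Gamma (1 - α)))
      (Ioi 1) :=
    (integrableOn_Ioi_rpow_of_lt (by linarith [hα.1]) one_pos).div_const _
  refine .union (near_zero.mono' hmeas.aestronglyMeasurable ?_)
    (near_infty.mono' hmeas.aestronglyMeasurable ?_)
  · filter_upwards [ae_restrict_mem measurableSet_Ioc] with r hr
    have hr0 : 0 < r := hr.1
    rw [Real.norm_of_nonneg (by positivity)]
    exact mul_le_of_le_one_right (by positivity) (inv_le_one_of_one_le₀ (by linarith))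
  · filter_upwards [ae_restrict_mem measurableSet_Ioi] with r hr
    have hr0 : 0 < r := one_pos.trans hr
    rw [Real.norm_of_nonneg (by positivity), Real.rpow_sub hr0, Real.rpow_one]
    calc r ^ (-α) / (Real.Gamma α * Real.Gamma (1 - α)) * (r + 1)⁻¹
        ≤ r ^ (-α) / (Real.Gamma α * Real.Gamma (1 - α)) * r⁻¹ := by gcongr; linarith
      _ = r ^ (-α) / r / (Real.Gamma α * Real.Gamma (1 - α)) := by ring

theorem integrable_inv_add_kernelMeasure (hα : α ∈ Ioo (0 : ℝ) 1) {l : ℝ} (hl : 1 ≤ l) :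
    Integrable (fun r => (r + l)⁻¹) (kernelMeasure α) := by
  refine (integrable_inv_add_one_kernelMeasure hα).mono'
    (by fun_prop : Measurable fun r : ℝ => (r + l)⁻¹).aestronglyMeasurable ?_
  filter_upwards [ae_pos_kernelMeasure α] with r hr
  rw [Real.norm_of_nonneg (by positivity)]
  gcongr

theorem tendsto_integral_inv_add_kernelMeasure (hα : α ∈ Ioo (0 : ℝ) 1) :
    Filter.Tendsto (fun l : ℝ => ∫ r, (r + l)⁻¹ ∂(kernelMeasure α)) Filter.atTop (nhds 0) := by
  rw [← integral_zero ℝ ℝ (μ := kernelMeasure α)]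
  refine tendsto_integral_filter_of_dominated_convergence _
    (.of_forall fun l => (by fun_prop : Measurable fun r : ℝ => (r + l)⁻¹).aestronglyMeasurable) ?_
    (integrable_inv_add_one_kernelMeasure hα) (.of_forall fun r =>
      tendsto_inv_atTop_zero.comp (Filter.tendsto_atTop_add_const_left _ r Filter.tendsto_id))
  filter_upwards [Filter.eventually_ge_atTop 1] with l hl
  filter_upwards [ae_pos_kernelMeasure α] with r hr
  rw [Real.norm_of_nonneg (by positivity)]
  gcongr

theorem kernelMeasure_Ioc_ne_zero (hα : α ∈ Ioo (0 : ℝ) 1) : kernelMeasure α (Ioc 0 1) ≠ 0 := by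
  intro h
  have hpos : ∀ᵐ r ∂(volume.restrict (Ioi (0 : ℝ))),
      ENNReal.ofReal (r ^ (-α) / (Real.Gamma α * Real.Gamma (1 - α))) ≠ 0 := by
    filter_upwards [ae_restrict_mem measurableSet_Ioi] with r hr
    exact (ENNReal.ofReal_pos.2 (kernelDensity_pos hα hr)).ne'
  have h0 := withDensity_absolutelyContinuous' (measurable_kernelDensity α).aemeasurable hpos h
  rw [Measure.restrict_apply measurableSet_Ioc,
    inter_eq_self_of_subset_left Ioc_subset_Ioi_self] at h0
  simp at h0

theorem kernelMeasure_Ioc_ne_top (hα : α ∈ Ioo (0 : ℝ) 1) : kernelMeasure α (Ioc 0 1) ≠ ⊤ := by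
  have h := (integrable_exp_kernelMeasure hα one_pos).measure_norm_ge_lt_top (Real.exp_pos (-1))
  refine ((measure_mono fun r hr => ?_).trans_lt h).ne
  simpa using hr.2

end Kernel

section FracInt

variable {H : Type} [NormedAddCommGroup H] [InnerProductSpace ℝ H] {α T : ℝ} {u : ℝ → H}

theorem fracInt_one (u : ℝ → H) (t : ℝ) : fracInt 1 u t = ∫ s in 0..t, u s := by
  simp [fracInt, omega]

theorem ae_intervalIntegrable_omega_smul {μ : ℝ} (hμ : 0 < μ) (hu : IntegrableOn u (Ioc 0 T)) :
    ∀ᵐ t ∂(volume.restrict (Ioc 0 T)),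
      IntervalIntegrable (fun s => omega μ (t - s) • u s) volume 0 t := by
  have hconv := (hu.integrable_indicator measurableSet_Ioc).ae_convolution_exists
    (ContinuousLinearMap.lsmul ℝ ℝ : ℝ →L[ℝ] H →L[ℝ] H).flip
    ((intervalIntegrable_omega hμ T).1.integrable_indicator measurableSet_Ioc)
  filter_upwards [ae_restrict_of_ae hconv, ae_restrict_mem measurableSet_Ioc] with t hint ht
  rw [intervalIntegrable_iff_integrableOn_Ioo_of_le ht.1.le]
  refine (IntegrableOn.congr_fun (Integrable.integrableOn hint) (fun s hs => ?_) measurableSet_Ioo)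
  have hs1 : s ∈ Ioc 0 T := ⟨hs.1, hs.2.le.trans ht.2⟩
  have hs2 : t - s ∈ Ioc 0 T := ⟨sub_pos.2 hs.2, by linarith [hs.1, ht.2]⟩
  simp [indicator_of_mem hs1, indicator_of_mem hs2]

theorem fracInt_eq_integral_expConv [CompleteSpace H] (hα : α ∈ Ioo (0 : ℝ) 1) {t : ℝ} (ht : 0 ≤ t)
    (hum : AEStronglyMeasurable u (volume.restrict (Ioc 0 t)))
    (hu : IntervalIntegrable (fun s => omega α (t - s) • u s) volume 0 t) :
    fracInt α u t = ∫ r, expConv r u t ∂(kernelMeasure α) := by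
  have hlt : ∀ᵐ s ∂(volume.restrict (Ioc 0 t)), 0 < t - s := by
    rw [← Measure.restrict_congr_set Ioo_ae_eq_Ioc]
    filter_upwards [ae_restrict_mem measurableSet_Ioo] with s hs
    exact sub_pos.2 hs.2
  have hF : Integrable (Function.uncurry fun s r => Real.exp (-(r * (t - s))) • u s)
      ((volume.restrict (Ioc 0 t)).prod (kernelMeasure α)) := by
    have hexp : Measurable fun p : ℝ × ℝ => Real.exp (-(p.2 * (t - p.1))) := by fun_prop
    have hmeas : AEStronglyMeasurable (Function.uncurry fun s r => Real.exp (-(r * (t - s))) • u s)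
        ((volume.restrict (Ioc 0 t)).prod (kernelMeasure α)) :=
      hexp.aestronglyMeasurable.smul hum.comp_fst
    refine (integrable_prod_iff hmeas).2 ⟨?_, hu.1.norm.congr ?_⟩
    · filter_upwards [hlt] with s hs
      exact (integrable_exp_kernelMeasure hα hs).smul_const (u s)
    · filter_upwards [hlt] with s hs
      simp only [Function.uncurry, norm_smul, Real.norm_eq_abs, Real.abs_exp, integral_mul_const]
      rw [integral_exp_kernelMeasure hα hs, abs_of_pos (omega_pos hα.1 hs)]
  calc fracInt α u t
      = ∫ s in Ioc 0 t, ∫ r, Real.exp (-(r * (t - s))) • u s ∂(kernelMeasure α) := by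
        rw [fracInt, intervalIntegral.integral_of_le ht]
        refine integral_congr_ae ?_
        filter_upwards [hlt] with s hs
        rw [integral_smul_const, integral_exp_kernelMeasure hα hs]
    _ = ∫ r, expConv r u t ∂(kernelMeasure α) := by
        rw [integral_integral_swap hF]
        simp only [expConv, intervalIntegral.integral_of_le ht]

theorem expTilt_fracInt_ae_eq [CompleteSpace H] (hα : α ∈ Ioo (0 : ℝ) 1)
    (hu : IntegrableOn u (Ioc 0 T)) (l : ℝ) :
    expTilt l (fracInt α u) =ᵐ[volume.restrict (Ioc 0 T)]
      fun t => ∫ r, expConv (r + l) (expTilt l u) t ∂(kernelMeasure α) := by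
  filter_upwards [ae_intervalIntegrable_omega_smul hα.1 hu, ae_restrict_mem measurableSet_Ioc]
    with t hint ht
  rw [expTilt, fracInt_eq_integral_expConv hα ht.1.le
    (hu.mono_set (Ioc_subset_Ioc_right ht.2)).aestronglyMeasurable hint, ← integral_smul]
  simp only [← expTilt_expConv, expTilt]

end FracInt

section Coercivity

variable {H : Type} [NormedAddCommGroup H] [InnerProductSpace ℝ H] {α T l : ℝ} {u : ℝ → H}

/-- The norm of `I^α u(t)` plus that of `∫₀ᵗ u`: the size of the present values of the two
fractional integrals entering the lower-order operators. -/
noncomputable def fracNorm (α : ℝ) (u : ℝ → H) (t : ℝ) : ℝ :=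
  ‖fracInt α u t‖ + ‖fracInt 1 u t‖

theorem fracNorm_nonneg (α : ℝ) (u : ℝ → H) (t : ℝ) : 0 ≤ fracNorm α u t :=
  add_nonneg (norm_nonneg _) (norm_nonneg _)

theorem expTilt_fracNorm (l α : ℝ) (u : ℝ → H) (t : ℝ) :
    expTilt l (fracNorm α u) t = ‖expTilt l (fracInt α u) t‖ + ‖expTilt l (fracInt 1 u) t‖ := by
  simp only [norm_expTilt]
  exact smul_add _ _ _

theorem memLp_fracInt_one (hT : 0 ≤ T) (hu : MemLp u 2 (volume.restrict (Ioc 0 T))) :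
    MemLp (fracInt 1 u) 2 (volume.restrict (Ioc 0 T)) := by
  have hui : IntervalIntegrable u volume 0 T :=
    (intervalIntegrable_iff_integrableOn_Ioc_of_le hT).2 (hu.integrable one_le_two)
  have hcont : ContinuousOn (fracInt 1 u) (Icc 0 T) := by
    rw [funext (fracInt_one u), ← uIcc_of_le hT]
    exact intervalIntegral.continuousOn_primitive_interval' hui left_mem_uIcc
  obtain ⟨C, hC⟩ := isCompact_Icc.exists_bound_of_continuousOn hcont
  refine .of_bound ((hcont.mono Ioc_subset_Icc_self).aestronglyMeasurable measurableSet_Ioc) C ?_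
  filter_upwards [ae_restrict_mem measurableSet_Ioc] with t ht
  exact hC t (Ioc_subset_Icc_self ht)

variable [CompleteSpace H]

theorem ae_add_pos_kernelMeasure (α : ℝ) (hl : 0 ≤ l) : ∀ᵐ r ∂(kernelMeasure α), 0 < r + l :=
  (ae_pos_kernelMeasure α).mono fun _ hr => add_pos_of_pos_of_nonneg hr hl

theorem integrable_mul_sq_expConv_kernelMeasure (hα : α ∈ Ioo (0 : ℝ) 1) (hl : 1 ≤ l) (hT : 0 ≤ T)
    (hu : MemLp u 2 (volume.restrict (Ioc 0 T))) :
    Integrable (fun r => (r + l) * ∫ t in 0..T, ‖expConv (r + l) (expTilt l u) t‖ ^ 2)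
      (kernelMeasure α) :=
  integrable_mul_integral_sq_expConv (by fun_prop)
    (ae_add_pos_kernelMeasure α (zero_le_one.trans hl)) (integrable_inv_add_kernelMeasure hα hl) hT
    (memLp_expTilt l hu)

theorem integral_mul_sq_expConv_le_integral_inner_fracInt (hα : α ∈ Ioo (0 : ℝ) 1) (hl : 1 ≤ l)
    (hT : 0 ≤ T) (hu : MemLp u 2 (volume.restrict (Ioc 0 T))) :
    ∫ r, ((r + l) * ∫ t in 0..T, ‖expConv (r + l) (expTilt l u) t‖ ^ 2) ∂(kernelMeasure α) ≤
      ∫ t in 0..T, inner ℝ (expTilt l u t) (expTilt l (fracInt α u) t) := by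
  refine (integral_mul_integral_sq_expConv_le (by fun_prop)
    (ae_add_pos_kernelMeasure α (zero_le_one.trans hl)) (integrable_inv_add_kernelMeasure hα hl) hT
    (memLp_expTilt l hu)).trans_eq ?_
  rw [intervalIntegral.integral_of_le hT, intervalIntegral.integral_of_le hT]
  refine integral_congr_ae ?_
  filter_upwards [expTilt_fracInt_ae_eq hα (hu.integrable one_le_two) l] with t ht
  rw [ht]

theorem memLp_fracInt (hα : α ∈ Ioo (0 : ℝ) 1) (hT : 0 ≤ T)
    (hu : MemLp u 2 (volume.restrict (Ioc 0 T))) :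
    MemLp (fracInt α u) 2 (volume.restrict (Ioc 0 T)) := by
  have htilt : MemLp (expTilt 1 (fracInt α u)) 2 (volume.restrict (Ioc 0 T)) :=
    (memLp_integral_expConv (by fun_prop) (ae_add_pos_kernelMeasure α zero_le_one)
      (integrable_inv_add_kernelMeasure hα le_rfl) hT (memLp_expTilt 1 hu)).1.ae_eq
      (expTilt_fracInt_ae_eq hα (hu.integrable one_le_two) 1).symm
  simpa only [expTilt_neg_expTilt] using memLp_expTilt (-1) htilt

theorem integral_sq_expTilt_fracInt_le (hα : α ∈ Ioo (0 : ℝ) 1) (hl : 1 ≤ l) (hT : 0 ≤ T)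
    (hu : MemLp u 2 (volume.restrict (Ioc 0 T))) :
    ∫ t in 0..T, ‖expTilt l (fracInt α u) t‖ ^ 2 ≤ (∫ r, (r + l)⁻¹ ∂(kernelMeasure α)) *
      ∫ t in 0..T, inner ℝ (expTilt l u t) (expTilt l (fracInt α u) t) := by
  have hpos := ae_add_pos_kernelMeasure α (zero_le_one.trans hl)
  calc ∫ t in 0..T, ‖expTilt l (fracInt α u) t‖ ^ 2
      = ∫ t in 0..T, ‖∫ r, expConv (r + l) (expTilt l u) t ∂(kernelMeasure α)‖ ^ 2 := by
        rw [intervalIntegral.integral_of_le hT, intervalIntegral.integral_of_le hT]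
        refine integral_congr_ae ?_
        filter_upwards [expTilt_fracInt_ae_eq hα (hu.integrable one_le_two) l] with t ht
        rw [ht]
    _ ≤ (∫ r, (r + l)⁻¹ ∂(kernelMeasure α)) *
        ∫ r, ((r + l) * ∫ t in 0..T, ‖expConv (r + l) (expTilt l u) t‖ ^ 2) ∂(kernelMeasure α) :=
        (memLp_integral_expConv (by fun_prop) hpos (integrable_inv_add_kernelMeasure hα hl) hT
          (memLp_expTilt l hu)).2
    _ ≤ _ := mul_le_mul_of_nonneg_left
        (integral_mul_sq_expConv_le_integral_inner_fracInt hα hl hT hu)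
        (integral_nonneg_of_ae (hpos.mono fun r hr => inv_nonneg.2 hr.le))

theorem mul_integral_sq_expTilt_primitive_le (hα : α ∈ Ioo (0 : ℝ) 1) (hl : 1 ≤ l) (hT : 0 ≤ T)
    (hu : MemLp u 2 (volume.restrict (Ioc 0 T))) :
    (kernelMeasure α).real (Ioc 0 1) * (l * ∫ t in 0..T, ‖expTilt l (fracInt 1 u) t‖ ^ 2) ≤
      4 * ∫ t in 0..T, inner ℝ (expTilt l u t) (expTilt l (fracInt α u) t) := by
  have hl0 : 0 < l := one_pos.trans_le hl
  have hv : IntervalIntegrable (expTilt l u) volume 0 T :=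
    (intervalIntegrable_iff_integrableOn_Ioc_of_le hT).2
      ((memLp_expTilt l hu).integrable one_le_two)
  set N : ℝ → ℝ := fun r => ∫ t in 0..T, ‖expConv (r + l) (expTilt l u) t‖ ^ 2
  have hN (r : ℝ) : 0 ≤ N r := intervalIntegral.integral_nonneg hT fun t _ => sq_nonneg _
  have hJ := integrable_mul_sq_expConv_kernelMeasure hα hl hT hu
  have hcompare : ∀ r ∈ Ioc (0 : ℝ) 1,
      l * (∫ t in 0..T, ‖expConv l (expTilt l u) t‖ ^ 2) ≤ 4 * ((r + l) * N r) := fun r hr => by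
    simpa only [N, add_comm r] using
      mul_integral_sq_expConv_le_add hl0 hr.1.le (hr.2.trans hl) hT hv
  simp only [funext (fracInt_one u), expTilt_primitive]
  calc (kernelMeasure α).real (Ioc 0 1) * (l * ∫ t in 0..T, ‖expConv l (expTilt l u) t‖ ^ 2)
      = ∫ _ in Ioc (0 : ℝ) 1, (l * ∫ t in 0..T, ‖expConv l (expTilt l u) t‖ ^ 2)
          ∂(kernelMeasure α) := by rw [setIntegral_const, smul_eq_mul]
    _ ≤ ∫ r in Ioc (0 : ℝ) 1, 4 * ((r + l) * N r) ∂(kernelMeasure α) :=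
        setIntegral_mono_on (integrableOn_const (kernelMeasure_Ioc_ne_top hα))
          (hJ.const_mul 4).integrableOn measurableSet_Ioc hcompare
    _ ≤ ∫ r, 4 * ((r + l) * N r) ∂(kernelMeasure α) := by
        refine setIntegral_le_integral (hJ.const_mul 4) ?_
        filter_upwards [ae_add_pos_kernelMeasure α hl0.le] with r hr
        exact mul_nonneg zero_le_four (mul_nonneg hr.le (hN r))
    _ ≤ _ := by
        rw [integral_const_mul]
        gcongr
        exact integral_mul_sq_expConv_le_integral_inner_fracInt hα hl hT hu

theorem memLp_fracNorm (hα : α ∈ Ioo (0 : ℝ) 1) (hT : 0 ≤ T)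
    (hu : MemLp u 2 (volume.restrict (Ioc 0 T))) :
    MemLp (fracNorm α u) 2 (volume.restrict (Ioc 0 T)) :=
  (memLp_fracInt hα hT hu).norm.add (memLp_fracInt_one hT hu).norm

theorem integral_sq_expTilt_fracNorm_le (hα : α ∈ Ioo (0 : ℝ) 1) (l : ℝ) (hT : 0 ≤ T)
    (hu : MemLp u 2 (volume.restrict (Ioc 0 T))) :
    ∫ t in 0..T, expTilt l (fracNorm α u) t ^ 2 ≤
      2 * ((∫ t in 0..T, ‖expTilt l (fracInt α u) t‖ ^ 2) +
        ∫ t in 0..T, ‖expTilt l (fracInt 1 u) t‖ ^ 2) := by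
  have h_sq {f : ℝ → H} (hf : MemLp f 2 (volume.restrict (Ioc 0 T))) :
      IntervalIntegrable (fun t => ‖expTilt l f t‖ ^ 2) volume 0 T :=
    (intervalIntegrable_iff_integrableOn_Ioc_of_le hT).2 (memLp_expTilt l hf).norm.integrable_sq
  have h₀ := h_sq (memLp_fracInt hα hT hu)
  have h₁ := h_sq (memLp_fracInt_one hT hu)
  rw [← intervalIntegral.integral_add h₀ h₁, ← intervalIntegral.integral_const_mul]
  refine intervalIntegral.integral_mono_on hT ?_ ((h₀.add h₁).const_mul 2) fun t _ => ?_
  · exact (intervalIntegrable_iff_integrableOn_Ioc_of_le hT).2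
      (memLp_expTilt l (memLp_fracNorm hα hT hu)).integrable_sq
  · rw [expTilt_fracNorm]
    exact add_sq_le

theorem exists_expTilt_coercive (H : Type) [NormedAddCommGroup H] [InnerProductSpace ℝ H]
    [CompleteSpace H] (hα : α ∈ Ioo (0 : ℝ) 1) (hT : 0 ≤ T) {C : ℝ} (hC : 0 < C) :
    ∃ l, 1 ≤ l ∧ ∀ u : ℝ → H, MemLp u 2 (volume.restrict (Ioc 0 T)) →
      C * ∫ t in 0..T, expTilt l (fracNorm α u) t ^ 2 ≤
        ∫ t in 0..T, inner ℝ (expTilt l u t) (expTilt l (fracInt α u) t) := by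
  set c := (kernelMeasure α).real (Ioc 0 1)
  have hc : 0 < c :=
    ENNReal.toReal_pos (kernelMeasure_Ioc_ne_zero hα) (kernelMeasure_Ioc_ne_top hα)
  have hsmall : ∀ᶠ l in Filter.atTop, ∫ r, (r + l)⁻¹ ∂(kernelMeasure α) < (4 * C)⁻¹ :=
    (tendsto_integral_inv_add_kernelMeasure hα).eventually_lt_const (by positivity)
  obtain ⟨l, hl, hK, hlc⟩ := ((Filter.eventually_ge_atTop 1).and
    (hsmall.and (Filter.eventually_ge_atTop (16 * C / c)))).exists
  refine ⟨l, hl, fun u hu => ?_⟩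
  set Q := ∫ t in 0..T, inner ℝ (expTilt l u t) (expTilt l (fracInt α u) t)
  have hQ : 0 ≤ Q := by
    refine le_trans (integral_nonneg_of_ae ?_)
      (integral_mul_sq_expConv_le_integral_inner_fracInt hα hl hT hu)
    filter_upwards [ae_add_pos_kernelMeasure α (zero_le_one.trans hl)] with r hr
    exact mul_nonneg hr.le (intervalIntegral.integral_nonneg hT fun t _ => sq_nonneg _)
  have hfrac : 4 * C * ∫ t in 0..T, ‖expTilt l (fracInt α u) t‖ ^ 2 ≤ Q := by
    rw [mul_comm, ← le_div_iff₀ (by positivity), div_eq_inv_mul]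
    exact (integral_sq_expTilt_fracInt_le hα hl hT hu).trans (by gcongr)
  have hprim : 4 * C * ∫ t in 0..T, ‖expTilt l (fracInt 1 u) t‖ ^ 2 ≤ Q := by
    have hnonneg : 0 ≤ ∫ t in 0..T, ‖expTilt l (fracInt 1 u) t‖ ^ 2 :=
      intervalIntegral.integral_nonneg hT fun t _ => sq_nonneg _
    have hbound := mul_integral_sq_expTilt_primitive_le hα hl hT hu
    have hcl : 16 * C ≤ c * l := by rwa [div_le_iff₀' hc] at hlc
    nlinarith [mul_le_mul_of_nonneg_right hcl hnonneg]
  have hsum := mul_le_mul_of_nonneg_left (integral_sq_expTilt_fracNorm_le hα l hT hu) hC.le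
  linarith

end Coercivity

section Gronwall

variable {H : Type} [NormedAddCommGroup H] [InnerProductSpace ℝ H] {α T l : ℝ} {u : ℝ → H}

/-- `fracNorm` together with its integral over the past: the quantity bounding the operators `B₁`
and `B₂`. -/
noncomputable def historyNorm (α : ℝ) (u : ℝ → H) (t : ℝ) : ℝ :=
  fracNorm α u t + ∫ s in 0..t, fracNorm α u s

theorem historyNorm_nonneg (α : ℝ) (u : ℝ → H) {t : ℝ} (ht : 0 ≤ t) : 0 ≤ historyNorm α u t :=
  add_nonneg (fracNorm_nonneg α u t)
    (intervalIntegral.integral_nonneg ht fun s _ => fracNorm_nonneg α u s)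

theorem norm_fracInt_le_historyNorm {t : ℝ} (ht : 0 ≤ t) : ‖fracInt α u t‖ ≤ historyNorm α u t :=
  (le_add_of_nonneg_right (norm_nonneg _)).trans (le_add_of_nonneg_right
    (intervalIntegral.integral_nonneg ht fun s _ => fracNorm_nonneg α u s))

theorem historyNorm_eq_fracNorm {t : ℝ} (ht : t ∈ Icc 0 T)
    (h : fracNorm α u =ᵐ[volume.restrict (Ioc 0 T)] 0) : historyNorm α u t = fracNorm α u t := by
  rw [historyNorm, add_eq_left, intervalIntegral.integral_of_le ht.1]
  exact integral_eq_zero_of_ae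
    (ae_restrict_of_ae_restrict_of_subset (Ioc_subset_Ioc_right ht.2) h)

theorem expTilt_historyNorm (l : ℝ) : expTilt l (historyNorm α u) =
    expTilt l (fracNorm α u) + expConv l (expTilt l (fracNorm α u)) := by
  ext t
  rw [Pi.add_apply, ← expTilt_primitive]
  exact smul_add _ _ _

variable [CompleteSpace H]

theorem memLp_historyNorm (hα : α ∈ Ioo (0 : ℝ) 1) (hT : 0 ≤ T)
    (hu : MemLp u 2 (volume.restrict (Ioc 0 T))) :
    MemLp (historyNorm α u) 2 (volume.restrict (Ioc 0 T)) := by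
  have hN := memLp_fracNorm hα hT hu
  have hprim := memLp_fracInt_one hT hN
  rw [funext (fracInt_one _)] at hprim
  exact hN.add hprim

theorem integral_sq_expTilt_historyNorm_le (hα : α ∈ Ioo (0 : ℝ) 1) (hl : 1 ≤ l) (hT : 0 ≤ T)
    (hu : MemLp u 2 (volume.restrict (Ioc 0 T))) :
    ∫ t in 0..T, expTilt l (historyNorm α u) t ^ 2 ≤
      4 * ∫ t in 0..T, expTilt l (fracNorm α u) t ^ 2 := by
  set a := expTilt l (fracNorm α u)
  have ha : MemLp a 2 (volume.restrict (Ioc 0 T)) := memLp_expTilt l (memLp_fracNorm hα hT hu)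
  have hai : IntervalIntegrable a volume 0 T :=
    (intervalIntegrable_iff_integrableOn_Ioc_of_le hT).2 (ha.integrable one_le_two)
  have ha2 : IntervalIntegrable (fun t => a t ^ 2) volume 0 T :=
    (intervalIntegrable_iff_integrableOn_Ioc_of_le hT).2 ha.integrable_sq
  have hy2 : IntervalIntegrable (fun t => expConv l a t ^ 2) volume 0 T :=
    ((continuousOn_expConv l hai).pow 2).intervalIntegrable
  have hh2 : IntervalIntegrable (fun t => expTilt l (historyNorm α u) t ^ 2) volume 0 T :=
    (intervalIntegrable_iff_integrableOn_Ioc_of_le hT).2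
      (memLp_expTilt l (memLp_historyNorm hα hT hu)).integrable_sq
  have hy : ∫ t in 0..T, expConv l a t ^ 2 ≤ ∫ t in 0..T, a t ^ 2 := by
    have henergy := sq_mul_integral_sq_expConv_le (one_pos.trans_le hl) hT hai (by simpa using ha2)
    simp only [Real.norm_eq_abs, sq_abs] at henergy
    exact (le_mul_of_one_le_left (intervalIntegral.integral_nonneg hT fun t _ => sq_nonneg _)
      (one_le_pow₀ hl)).trans henergy
  calc ∫ t in 0..T, expTilt l (historyNorm α u) t ^ 2
      ≤ ∫ t in 0..T, 2 * (a t ^ 2 + expConv l a t ^ 2) :=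
        intervalIntegral.integral_mono_on hT hh2 ((ha2.add hy2).const_mul 2) fun t _ => by
          rw [expTilt_historyNorm]
          exact add_sq_le
    _ = 2 * ((∫ t in 0..T, a t ^ 2) + ∫ t in 0..T, expConv l a t ^ 2) := by
        rw [intervalIntegral.integral_const_mul, intervalIntegral.integral_add ha2 hy2]
    _ ≤ 4 * ∫ t in 0..T, a t ^ 2 := by linarith

theorem integral_inner_expTilt_fracInt_le (hα : α ∈ Ioo (0 : ℝ) 1) (hT : 0 ≤ T) {C : ℝ}
    (hu : MemLp u 2 (volume.restrict (Ioc 0 T)))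
    (hle : ∀ᵐ t ∂(volume.restrict (Ioc 0 T)),
      inner ℝ (u t) (fracInt α u t) ≤ C * historyNorm α u t ^ 2) (l : ℝ) :
    ∫ t in 0..T, inner ℝ (expTilt l u t) (expTilt l (fracInt α u) t) ≤
      C * ∫ t in 0..T, expTilt l (historyNorm α u) t ^ 2 := by
  have hv := memLp_expTilt l hu
  have hw := memLp_expTilt l (memLp_fracInt hα hT hu)
  rw [intervalIntegral.integral_of_le hT, intervalIntegral.integral_of_le hT, ← integral_const_mul]
  refine integral_mono_ae ?_
    ((memLp_expTilt l (memLp_historyNorm hα hT hu)).integrable_sq.const_mul C) ?_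
  · exact (hv.norm.integrable_mul hw.norm).mono' (hv.1.inner hw.1)
      (.of_forall fun t => norm_inner_le_norm _ _)
  · filter_upwards [hle] with t ht
    calc inner ℝ (expTilt l u t) (expTilt l (fracInt α u) t)
        = Real.exp (-(l * t)) ^ 2 * inner ℝ (u t) (fracInt α u t) := by
          rw [expTilt, expTilt, real_inner_smul_left, real_inner_smul_right, sq, mul_assoc]
      _ ≤ Real.exp (-(l * t)) ^ 2 * (C * historyNorm α u t ^ 2) := by gcongr
      _ = C * expTilt l (historyNorm α u) t ^ 2 := by rw [expTilt, smul_eq_mul]; ring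

theorem ae_fracNorm_eq_zero_of_inner_le (hα : α ∈ Ioo (0 : ℝ) 1) (hT : 0 ≤ T) {C : ℝ}
    (hC : 0 ≤ C) (hu : MemLp u 2 (volume.restrict (Ioc 0 T)))
    (hle : ∀ᵐ t ∂(volume.restrict (Ioc 0 T)),
      inner ℝ (u t) (fracInt α u t) ≤ C * historyNorm α u t ^ 2) :
    fracNorm α u =ᵐ[volume.restrict (Ioc 0 T)] 0 := by
  obtain ⟨l, hl, hcoercive⟩ :=
    exists_expTilt_coercive H hα hT (C := 4 * C + 1) (by positivity)
  have hupper := (hcoercive u hu).trans ((integral_inner_expTilt_fracInt_le hα hT hu hle l).trans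
    (mul_le_mul_of_nonneg_left (integral_sq_expTilt_historyNorm_le hα hl hT hu) hC))
  have hzero : ∫ t in 0..T, expTilt l (fracNorm α u) t ^ 2 = 0 :=
    le_antisymm (by linarith) (intervalIntegral.integral_nonneg hT fun t _ => sq_nonneg _)
  rw [intervalIntegral.integral_of_le hT, integral_eq_zero_iff_of_nonneg (fun t => sq_nonneg _)
    (memLp_expTilt l (memLp_fracNorm hα hT hu)).integrable_sq] at hzero
  filter_upwards [hzero] with t ht
  simpa [expTilt] using ht

end Gronwall

section Sobolev

variable {d : ℕ} {Ω : Set (E d)}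

theorem IsTestFunction.sub {φ χ : E d → ℝ} (hφ : IsTestFunction Ω φ) (hχ : IsTestFunction Ω χ) :
    IsTestFunction Ω (φ - χ) :=
  ⟨hφ.1.sub hχ.1, hφ.2.1.sub hχ.2.1, (tsupport_sub φ χ).trans (union_subset hφ.2.2 hχ.2.2)⟩

theorem IsTestFunction.gradient_sub {φ χ : E d → ℝ} (hφ : IsTestFunction Ω φ)
    (hχ : IsTestFunction Ω χ) : gradient (φ - χ) = gradient φ - gradient χ := by
  ext1 x
  have hφx : DifferentiableAt ℝ φ x := hφ.1.differentiable (by simp) x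
  have hχx : DifferentiableAt ℝ χ x := hχ.1.differentiable (by simp) x
  simp only [gradient, Pi.sub_apply, fderiv_sub hφx hχx, map_sub]

theorem H10_sub_mem {v w : LpOn Ω ℝ 2 × LpOn Ω (E d) 2} (hv : v ∈ H10 Ω) (hw : w ∈ H10 Ω) :
    v - w ∈ H10 Ω := by
  refine map_mem_closure₂ continuous_sub hv hw ?_
  rintro a ⟨φ, hφ, haφ, ha_grad⟩ b ⟨χ, hχ, hbχ, hb_grad⟩
  refine ⟨φ - χ, hφ.sub hχ, (Lp.coeFn_sub a.1 b.1).trans (haφ.sub hbχ), ?_⟩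
  rw [hφ.gradient_sub hχ]
  exact (Lp.coeFn_sub a.2 b.2).trans (ha_grad.sub hb_grad)

theorem IsTestFunction.exists_mem_H10 {φ : E d → ℝ} (hφ : IsTestFunction Ω φ) :
    ∃ v ∈ H10 Ω, v.1 =ᵐ[volume.restrict Ω] φ := by
  have hgrad : gradient φ = (InnerProductSpace.toDual ℝ (E d)).symm ∘ fderiv ℝ φ := rfl
  have hφ2 : MemLp φ 2 (volume.restrict Ω) := hφ.1.continuous.memLp_of_hasCompactSupport hφ.2.1
  have hgrad2 : MemLp (gradient φ) 2 (volume.restrict Ω) := by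
    rw [hgrad]
    exact ((LinearIsometryEquiv.continuous _).comp
      (hφ.1.continuous_fderiv (by simp))).memLp_of_hasCompactSupport
      ((hφ.2.1.fderiv ℝ).comp_left (map_zero _))
  exact ⟨(hφ2.toLp φ, hgrad2.toLp _), subset_closure ⟨φ, hφ, hφ2.coeFn_toLp, hgrad2.coeFn_toLp⟩,
    hφ2.coeFn_toLp⟩

theorem eq_zero_of_forall_H10_inner_eq_zero (hΩ : IsOpen Ω) {q : LpOn Ω ℝ 2}
    (h : ∀ v ∈ H10 Ω, inner ℝ q v.1 = 0) : q = 0 := by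
  have hq : LocallyIntegrableOn q Ω :=
    locallyIntegrableOn_of_locallyIntegrable_restrict ((Lp.memLp q).locallyIntegrable one_le_two)
  rw [Lp.eq_zero_iff_ae_eq_zero]
  refine (ae_restrict_iff' hΩ.measurableSet).2
    (hΩ.ae_eq_zero_of_integral_contDiff_smul_eq_zero hq fun φ hsmooth hcompact hsupp => ?_)
  obtain ⟨v, hv, hvφ⟩ := IsTestFunction.exists_mem_H10 (Ω := Ω) ⟨hsmooth, hcompact, hsupp⟩
  calc ∫ x, φ x • q x = ∫ x in Ω, φ x • q x := by
        refine (setIntegral_eq_integral_of_forall_compl_eq_zero fun x hx => ?_).symm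
        rw [image_eq_zero_of_notMem_tsupport fun hx' => hx (hsupp hx'), zero_smul]
    _ = inner ℝ q v.1 := by
        rw [L2.inner_def]
        refine integral_congr_ae ?_
        filter_upwards [hvφ] with x hx
        simp [hx]
    _ = 0 := h v hv

end Sobolev

section KappaForm

variable {d : ℕ} {Ω : Set (E d)} {D : Data Ω}

theorem memLp_coord (p : LpOn Ω (E d) 2) (i : Fin d) :
    MemLp (fun x => (p x).ofLp i) 2 (volume.restrict Ω) :=
  (EuclideanSpace.proj (𝕜 := ℝ) i).comp_memLp' (Lp.memLp p)

theorem integrable_kappaForm (hκ : ∀ i j, MemLp (fun x => D.κ x i j) ∞ (volume.restrict Ω))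
    (p q : LpOn Ω (E d) 2) :
    IntegrableOn (fun x => (D.κ x).mulVec (p x).ofLp ⬝ᵥ (q x).ofLp) Ω := by
  simp only [dotProduct, Matrix.mulVec, Finset.sum_mul]
  refine integrable_finsetSum _ fun i _ => integrable_finsetSum _ fun j _ => ?_
  have hκp : MemLp (fun x => D.κ x i j * (p x).ofLp j) 2 (volume.restrict Ω) :=
    (memLp_coord p j).mul' (hκ i j)
  exact hκp.integrable_mul (memLp_coord q i)

theorem kappaForm_sub_left (hκ : ∀ i j, MemLp (fun x => D.κ x i j) ∞ (volume.restrict Ω))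
    (p₁ p₂ q : LpOn Ω (E d) 2) :
    D.kappaForm (p₁ - p₂) q = D.kappaForm p₁ q - D.kappaForm p₂ q := by
  simp only [Data.kappaForm]
  rw [← integral_sub (integrable_kappaForm hκ p₁ q) (integrable_kappaForm hκ p₂ q)]
  refine integral_congr_ae ?_
  filter_upwards [Lp.coeFn_sub p₁ p₂] with x hx
  rw [hx, Pi.sub_apply, WithLp.ofLp_sub, Matrix.mulVec_sub, sub_dotProduct]

theorem kappaForm_zero_left (D : Data Ω) (q : LpOn Ω (E d) 2) : D.kappaForm 0 q = 0 := by
  refine integral_eq_zero_of_ae ?_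
  filter_upwards [Lp.coeFn_zero (E d) 2 (volume.restrict Ω)] with x hx
  rw [hx, Pi.zero_apply, WithLp.ofLp_zero, Matrix.mulVec_zero, zero_dotProduct, Pi.zero_apply]

theorem mul_sq_norm_le_kappaForm
    (hκ : ∀ i j, MemLp (fun x => D.κ x i j) ∞ (volume.restrict Ω)) {c : ℝ}
    (hc : ∀ᵐ x ∂(volume.restrict Ω), ∀ ξ : Fin d → ℝ, c * (ξ ⬝ᵥ ξ) ≤ ξ ⬝ᵥ (D.κ x).mulVec ξ)
    (p : LpOn Ω (E d) 2) : c * ‖p‖ ^ 2 ≤ D.kappaForm p p := by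
  rw [← real_inner_self_eq_norm_sq, L2.inner_def, ← integral_const_mul]
  refine integral_mono_ae ((L2.integrable_inner p p).const_mul c) (integrable_kappaForm hκ p p) ?_
  filter_upwards [hc] with x hx
  calc c * inner ℝ (p x) (p x) = c * ((p x).ofLp ⬝ᵥ (p x).ofLp) := by
        rw [real_inner_self_eq_norm_sq, EuclideanSpace.real_norm_sq_eq, dotProduct]
        simp only [sq]
    _ ≤ (D.κ x).mulVec (p x).ofLp ⬝ᵥ (p x).ofLp := by
        rw [dotProduct_comm ((D.κ x).mulVec _)]
        exact hx _

end KappaForm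

section Operators

variable {d : ℕ} {Ω : Set (E d)} {V : Type} [NormedAddCommGroup V] [NormedSpace ℝ V] {T α μ : ℝ}

theorem Lp_sub_smul (f g : LpOn Ω ℝ 2) (ψ : LpOn Ω V ∞) :
    ((f - g) • ψ : LpOn Ω V 2) = (f • ψ : LpOn Ω V 2) - (g • ψ : LpOn Ω V 2) := by
  rw [sub_eq_add_neg, Lp.smul_add, Lp.neg_smul, ← sub_eq_add_neg]

theorem norm_Lp_smul_le {M : ℝ} (f : LpOn Ω ℝ 2) {ψ : LpOn Ω V ∞} (hψ : ‖ψ‖ ≤ M) :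
    ‖(f • ψ : LpOn Ω V 2)‖ ≤ M * ‖f‖ :=
  (Lp.norm_smul_le f ψ).trans (by rw [mul_comm]; gcongr)

theorem exists_norm_le_of_contDiffOn (hT : 0 < T) {X : Type*} [NormedAddCommGroup X]
    [NormedSpace ℝ X] {ψ : ℝ → X} (hψ : ContDiffOn ℝ 1 ψ (Icc 0 T)) :
    ∃ M, ∀ t ∈ Icc 0 T, ‖ψ t‖ ≤ M ∧ ‖derivWithin ψ (Icc 0 T) t‖ ≤ M := by
  obtain ⟨M₀, h₀⟩ := isCompact_Icc.exists_bound_of_continuousOn hψ.continuousOn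
  obtain ⟨M₁, h₁⟩ := isCompact_Icc.exists_bound_of_continuousOn
    (hψ.continuousOn_derivWithin (uniqueDiffOn_Icc hT) le_rfl)
  exact ⟨max M₀ M₁, fun t ht =>
    ⟨(h₀ t ht).trans (le_max_left _ _), (h₁ t ht).trans (le_max_right _ _)⟩⟩

theorem integrableOn_smul_continuousOn {W : ℝ → LpOn Ω ℝ 2} {ψ : ℝ → LpOn Ω V ∞}
    (hW : IntegrableOn W (Ioc 0 T)) (hψ : ContinuousOn ψ (Icc 0 T)) :
    IntegrableOn (fun s => (W s • ψ s : LpOn Ω V 2)) (Ioc 0 T) := by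
  obtain ⟨M, hM⟩ := isCompact_Icc.exists_bound_of_continuousOn hψ
  have hmeas : AEStronglyMeasurable (fun s => (W s • ψ s : LpOn Ω V 2))
      (volume.restrict (Ioc 0 T)) :=
    ((ContinuousLinearMap.lsmul ℝ ℝ : ℝ →L[ℝ] V →L[ℝ] V).holderL (volume.restrict Ω) 2 ∞ 2
      |>.aestronglyMeasurable_comp₂ hW.1
        ((hψ.mono Ioc_subset_Icc_self).aestronglyMeasurable measurableSet_Ioc))
  refine (hW.norm.const_mul M).mono' hmeas ?_
  filter_upwards [ae_restrict_mem measurableSet_Ioc] with s hs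
  exact norm_Lp_smul_le _ (hM s (Ioc_subset_Icc_self hs))

theorem fracInt_sub {X : Type} [NormedAddCommGroup X] [NormedSpace ℝ X] {u₁ u₂ : ℝ → X} {t : ℝ}
    (h₁ : IntervalIntegrable (fun s => omega μ (t - s) • u₁ s) volume 0 t)
    (h₂ : IntervalIntegrable (fun s => omega μ (t - s) • u₂ s) volume 0 t) :
    fracInt μ (u₁ - u₂) t = fracInt μ u₁ t - fracInt μ u₂ t := by
  simp only [fracInt, Pi.sub_apply, smul_sub]
  exact intervalIntegral.integral_sub h₁ h₂

theorem opB_sub (hT : 0 < T) (hμ : 0 < μ) {ψ : ℝ → LpOn Ω V ∞} (hψ : ContDiffOn ℝ 1 ψ (Icc 0 T))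
    {u₁ u₂ : ℝ → LpOn Ω ℝ 2} (hu₁ : IntegrableOn u₁ (Ioc 0 T)) (hu₂ : IntegrableOn u₂ (Ioc 0 T))
    (hI₁ : IntegrableOn (fracInt μ u₁) (Ioc 0 T)) (hI₂ : IntegrableOn (fracInt μ u₂) (Ioc 0 T))
    {t : ℝ} (ht : t ∈ Icc 0 T)
    (h₁ : IntervalIntegrable (fun s => omega μ (t - s) • u₁ s) volume 0 t)
    (h₂ : IntervalIntegrable (fun s => omega μ (t - s) • u₂ s) volume 0 t) :
    opB T μ ψ (u₁ - u₂) t = opB T μ ψ u₁ t - opB T μ ψ u₂ t := by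
  have hsubset : Ioc 0 t ⊆ Ioc 0 T := Ioc_subset_Ioc_right ht.2
  have hψ' := hψ.continuousOn_derivWithin (uniqueDiffOn_Icc hT) le_rfl
  have hmemory : (∫ s in 0..t, (fracInt μ (u₁ - u₂) s • derivWithin ψ (Icc 0 T) s : LpOn Ω V 2)) =
      (∫ s in 0..t, (fracInt μ u₁ s • derivWithin ψ (Icc 0 T) s : LpOn Ω V 2)) -
        ∫ s in 0..t, (fracInt μ u₂ s • derivWithin ψ (Icc 0 T) s : LpOn Ω V 2) := by
    simp only [intervalIntegral.integral_of_le ht.1]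
    rw [← integral_sub ((integrableOn_smul_continuousOn hI₁ hψ').mono_set hsubset)
      ((integrableOn_smul_continuousOn hI₂ hψ').mono_set hsubset)]
    refine integral_congr_ae ?_
    filter_upwards [ae_restrict_of_ae_restrict_of_subset hsubset
        (ae_intervalIntegrable_omega_smul hμ hu₁),
      ae_restrict_of_ae_restrict_of_subset hsubset (ae_intervalIntegrable_omega_smul hμ hu₂)]
      with s hs₁ hs₂
    rw [fracInt_sub hs₁ hs₂, Lp_sub_smul]
  rw [opB, opB, opB, hmemory, fracInt_sub h₁ h₂, Lp_sub_smul]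
  abel

theorem norm_opB_le {ψ : ℝ → LpOn Ω V ∞} {M : ℝ}
    (hM : ∀ t ∈ Icc 0 T, ‖ψ t‖ ≤ M ∧ ‖derivWithin ψ (Icc 0 T) t‖ ≤ M) {u : ℝ → LpOn Ω ℝ 2}
    (hI : IntegrableOn (fracInt μ u) (Ioc 0 T)) {t : ℝ} (ht : t ∈ Icc 0 T) :
    ‖opB T μ ψ u t‖ ≤ M * (‖fracInt μ u t‖ + ∫ s in 0..t, ‖fracInt μ u s‖) := by
  have hI' : IntervalIntegrable (fracInt μ u) volume 0 t :=
    (intervalIntegrable_iff_integrableOn_Ioc_of_le ht.1).2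
      (hI.mono_set (Ioc_subset_Ioc_right ht.2))
  rw [mul_add, ← intervalIntegral.integral_const_mul]
  refine (norm_sub_le _ _).trans (add_le_add (norm_Lp_smul_le _ (hM t ht).1) ?_)
  exact intervalIntegral.norm_integral_le_of_norm_le ht.1
    (.of_forall fun s hs => norm_Lp_smul_le _ (hM s ⟨hs.1.le, hs.2.trans ht.2⟩).2)
    (hI'.norm.const_mul M)

theorem exists_norm_opB_add_opB_le (hT : 0 < T) (hα : α ∈ Ioo (0 : ℝ) 1) {ψ χ : ℝ → LpOn Ω V ∞}
    (hψ : ContDiffOn ℝ 1 ψ (Icc 0 T)) (hχ : ContDiffOn ℝ 1 χ (Icc 0 T)) :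
    ∃ M, ∀ u : ℝ → LpOn Ω ℝ 2, MemLp u 2 (volume.restrict (Ioc 0 T)) → ∀ t ∈ Icc 0 T,
      ‖opB T α ψ u t + opB T 1 χ u t‖ ≤ M * historyNorm α u t := by
  obtain ⟨M₀, h₀⟩ := exists_norm_le_of_contDiffOn hT hψ
  obtain ⟨M₁, h₁⟩ := exists_norm_le_of_contDiffOn hT hχ
  refine ⟨max M₀ M₁, fun u hu t ht => ?_⟩
  have hIα := (memLp_fracInt hα hT.le hu).integrable one_le_two
  have hI1 := (memLp_fracInt_one hT.le hu).integrable one_le_two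
  have hbound₀ := norm_opB_le (M := max M₀ M₁) (fun s hs =>
    (h₀ s hs).imp (le_max_of_le_left ·) (le_max_of_le_left ·)) hIα ht
  have hbound₁ := norm_opB_le (M := max M₀ M₁) (fun s hs =>
    (h₁ s hs).imp (le_max_of_le_right ·) (le_max_of_le_right ·)) hI1 ht
  have hnorm {w : ℝ → LpOn Ω ℝ 2} (hw : IntegrableOn w (Ioc 0 T)) :
      IntervalIntegrable (fun s => ‖w s‖) volume 0 t :=
    ((intervalIntegrable_iff_integrableOn_Ioc_of_le ht.1).2
      (hw.mono_set (Ioc_subset_Ioc_right ht.2))).norm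
  calc ‖opB T α ψ u t + opB T 1 χ u t‖ ≤ ‖opB T α ψ u t‖ + ‖opB T 1 χ u t‖ := norm_add_le _ _
    _ ≤ _ := add_le_add hbound₀ hbound₁
    _ = max M₀ M₁ * historyNorm α u t := by
        simp only [historyNorm, fracNorm]
        rw [intervalIntegral.integral_add (hnorm hIα) (hnorm hI1)]
        ring

end Operators

section Uniqueness

variable {d : ℕ} {Ω : Set (E d)}

/-- The coefficient assumptions behind uniqueness: `κ` is bounded and uniformly elliptic, and the
lower-order coefficients are `C¹` functions of time with values in `L_∞(Ω)`. -/
structure Data.WeaklyAdmissible (D : Data Ω) (T : ℝ) : Prop where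
  kappa_bounded : ∀ i j, MemLp (fun x => D.κ x i j) ∞ (volume.restrict Ω)
  kappa_elliptic : ∃ c > 0, ∀ᵐ x ∂(volume.restrict Ω), ∀ ξ : Fin d → ℝ,
    c * (ξ ⬝ᵥ ξ) ≤ ξ ⬝ᵥ (D.κ x).mulVec ξ
  F_reg : ContDiffOn ℝ 1 D.F (Icc 0 T)
  G_reg : ContDiffOn ℝ 1 D.G (Icc 0 T)
  a_reg : ContDiffOn ℝ 1 D.a (Icc 0 T)
  b_reg : ContDiffOn ℝ 1 D.b (Icc 0 T)

/-- The data of the problem solved by the difference of two solutions: same coefficients, no source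
and no initial value. -/
noncomputable def Data.homogeneous (D : Data Ω) : Data Ω := { D with g := 0, u₀ := 0 }

variable {D : Data Ω} {T α c M t : ℝ} {u u₁ u₂ : ℝ → LpOn Ω ℝ 2} {p p₁ p₂ : LpOn Ω (E d) 2}

theorem Data.Admissible.weaklyAdmissible (hD : D.Admissible T) : D.WeaklyAdmissible T where
  kappa_bounded := hD.kappa_bounded
  kappa_elliptic := hD.kappa_elliptic
  F_reg := hD.F_reg.1.of_le (by norm_num)
  G_reg := hD.G_reg.1.of_le (by norm_num)
  a_reg := hD.a_reg
  b_reg := hD.b_reg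

theorem Data.WeaklyAdmissible.homogeneous (hD : D.WeaklyAdmissible T) :
    D.homogeneous.WeaklyAdmissible T :=
  ⟨hD.1, hD.2, hD.3, hD.4, hD.5, hD.6⟩

theorem homogeneous_f (D : Data Ω) (t : ℝ) : D.homogeneous.f t = 0 := by
  simp [Data.f, Data.homogeneous]

theorem Data.WeakEqAt.sub (hT : 0 < T) (hα : α ∈ Ioo (0 : ℝ) 1) (hD : D.WeaklyAdmissible T)
    (hu₁ : MemLp u₁ 2 (volume.restrict (Ioc 0 T))) (hu₂ : MemLp u₂ 2 (volume.restrict (Ioc 0 T)))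
    (ht : t ∈ Icc 0 T) (h₁ : D.WeakEqAt T α u₁ p₁ t) (h₂ : D.WeakEqAt T α u₂ p₂ t) :
    D.homogeneous.WeakEqAt T α (u₁ - u₂) (p₁ - p₂) t := by
  have hi₁ := hu₁.integrable one_le_two
  have hi₂ := hu₂.integrable one_le_two
  have hIα {w : ℝ → LpOn Ω ℝ 2} (hw : MemLp w 2 (volume.restrict (Ioc 0 T))) :=
    (memLp_fracInt hα hT.le hw).integrable one_le_two
  have hI1 {w : ℝ → LpOn Ω ℝ 2} (hw : MemLp w 2 (volume.restrict (Ioc 0 T))) :=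
    (memLp_fracInt_one hT.le hw).integrable one_le_two
  have hone {w : ℝ → LpOn Ω ℝ 2} (hw : IntegrableOn w (Ioc 0 T)) :
      IntervalIntegrable (fun s => omega 1 (t - s) • w s) volume 0 t := by
    simpa [omega] using (intervalIntegrable_iff_integrableOn_Ioc_of_le ht.1).2
      (hw.mono_set (Ioc_subset_Ioc_right ht.2))
  have hB₁ : D.homogeneous.B₁ T α (u₁ - u₂) t = D.B₁ T α u₁ t - D.B₁ T α u₂ t := by
    simp only [Data.B₁, Data.homogeneous]
    rw [opB_sub hT hα.1 hD.F_reg hi₁ hi₂ (hIα hu₁) (hIα hu₂) ht h₁.1 h₂.1,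
      opB_sub hT one_pos hD.G_reg hi₁ hi₂ (hI1 hu₁) (hI1 hu₂) ht (hone hi₁) (hone hi₂)]
    abel
  have hB₂ : D.homogeneous.B₂ T α (u₁ - u₂) t = D.B₂ T α u₁ t - D.B₂ T α u₂ t := by
    simp only [Data.B₂, Data.homogeneous]
    rw [opB_sub hT hα.1 hD.a_reg hi₁ hi₂ (hIα hu₁) (hIα hu₂) ht h₁.1 h₂.1,
      opB_sub hT one_pos hD.b_reg hi₁ hi₂ (hI1 hu₁) (hI1 hu₂) ht (hone hi₁) (hone hi₂)]
    abel
  refine ⟨by simpa only [Pi.sub_apply, smul_sub] using h₁.1.sub h₂.1, ?_, fun v hv => ?_⟩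
  · rw [fracInt_sub h₁.1 h₂.1]
    exact H10_sub_mem h₁.2.1 h₂.2.1
  · have heq₁ := h₁.2.2 v hv
    have heq₂ := h₂.2.2 v hv
    have hκ : D.homogeneous.kappaForm (p₁ - p₂) v.2 = D.kappaForm p₁ v.2 - D.kappaForm p₂ v.2 :=
      kappaForm_sub_left hD.kappa_bounded p₁ p₂ v.2
    rw [homogeneous_f, hB₁, hB₂, hκ, Pi.sub_apply]
    simp only [inner_sub_left, inner_zero_left]
    linarith

theorem exists_norm_B_le (hT : 0 < T) (hα : α ∈ Ioo (0 : ℝ) 1) (hD : D.WeaklyAdmissible T) :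
    ∃ M, 0 ≤ M ∧ ∀ u, MemLp u 2 (volume.restrict (Ioc 0 T)) → ∀ t ∈ Icc 0 T,
      ‖D.B₁ T α u t‖ ≤ M * historyNorm α u t ∧ ‖D.B₂ T α u t‖ ≤ M * historyNorm α u t := by
  obtain ⟨M₁, h₁⟩ := exists_norm_opB_add_opB_le hT hα hD.F_reg hD.G_reg
  obtain ⟨M₂, h₂⟩ := exists_norm_opB_add_opB_le hT hα hD.a_reg hD.b_reg
  refine ⟨max 0 (max M₁ M₂), le_max_left _ _, fun u hu t ht => ?_⟩
  have hN := historyNorm_nonneg α u ht.1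
  exact ⟨(h₁ u hu t ht).trans (by gcongr; simp), (h₂ u hu t ht).trans (by gcongr; simp)⟩

theorem inner_fracInt_le (hc : 0 < c) (hM : 0 ≤ M) (ht : 0 ≤ t)
    (hκ : c * ‖p‖ ^ 2 ≤ D.kappaForm p p) (hf : D.f t = 0) (h : D.WeakEqAt T α u p t)
    (hB₁ : ‖D.B₁ T α u t‖ ≤ M * historyNorm α u t)
    (hB₂ : ‖D.B₂ T α u t‖ ≤ M * historyNorm α u t) :
    inner ℝ (u t) (fracInt α u t) ≤ (M ^ 2 / (4 * c) + M) * historyNorm α u t ^ 2 := by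
  set N := historyNorm α u t
  have hN : 0 ≤ N := historyNorm_nonneg α u ht
  have htest := h.2.2 _ h.2.1
  rw [hf, inner_zero_left] at htest
  have hinner₁ : inner ℝ (D.B₁ T α u t) p ≤ M * N * ‖p‖ :=
    (real_inner_le_norm _ _).trans (mul_le_mul_of_nonneg_right hB₁ (norm_nonneg _))
  have hinner₂ : -(M * N * N) ≤ inner ℝ (D.B₂ T α u t) (fracInt α u t) :=
    (abs_le.1 ((abs_real_inner_le_norm _ _).trans (mul_le_mul hB₂
      (norm_fracInt_le_historyNorm ht) (norm_nonneg _) (mul_nonneg hM hN)))).1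
  have hyoung : M * N * ‖p‖ - c * ‖p‖ ^ 2 ≤ M ^ 2 / (4 * c) * N ^ 2 := by
    have hsquare : M ^ 2 / (4 * c) * N ^ 2 - (M * N * ‖p‖ - c * ‖p‖ ^ 2) =
        c * (‖p‖ - M * N / (2 * c)) ^ 2 := by field_simp; ring
    have hnonneg : 0 ≤ c * (‖p‖ - M * N / (2 * c)) ^ 2 := by positivity
    linarith
  linarith

theorem eq_zero_of_historyNorm_eq_zero (hΩ : IsOpen Ω) (hc : 0 < c) (ht : 0 ≤ t)
    (hκ : c * ‖p‖ ^ 2 ≤ D.kappaForm p p) (hf : D.f t = 0) (h : D.WeakEqAt T α u p t)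
    (hB₁ : ‖D.B₁ T α u t‖ ≤ M * historyNorm α u t)
    (hB₂ : ‖D.B₂ T α u t‖ ≤ M * historyNorm α u t) (hN : historyNorm α u t = 0) : u t = 0 := by
  rw [hN, mul_zero, norm_le_zero_iff] at hB₁ hB₂
  have hw : fracInt α u t = 0 := norm_le_zero_iff.1 (hN ▸ norm_fracInt_le_historyNorm ht)
  have hp : p = 0 := by
    have htest := h.2.2 _ h.2.1
    simp only [hw, hB₁, hB₂, hf, inner_zero_left, inner_zero_right, zero_add, sub_zero,
      add_zero] at htest
    rw [htest] at hκ
    exact norm_eq_zero.1 (pow_eq_zero_iff two_ne_zero |>.1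
      (le_antisymm (nonpos_of_mul_nonpos_right hκ hc) (sq_nonneg _)))
  refine eq_zero_of_forall_H10_inner_eq_zero hΩ fun v hv => ?_
  simpa [hp, hB₁, hB₂, hf, kappaForm_zero_left] using h.2.2 v hv

theorem fracInt_eq_zero_of_ae_eq_zero {μ : ℝ} (hu : u =ᵐ[volume.restrict (Ioc 0 T)] 0)
    (ht : t ∈ Icc 0 T) : fracInt μ u t = 0 := by
  rw [fracInt, intervalIntegral.integral_of_le ht.1]
  refine integral_eq_zero_of_ae ?_
  filter_upwards [ae_restrict_of_ae_restrict_of_subset (Ioc_subset_Ioc_right ht.2) hu] with s hs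
  simp only [hs, Pi.zero_apply, smul_zero]

theorem eq_zero_of_weakEqAt (hΩ : IsOpen Ω) (hT : 0 < T) (hα : α ∈ Ioo (0 : ℝ) 1)
    (hD : D.WeaklyAdmissible T) (hf : ∀ t, D.f t = 0)
    (hu : MemLp u 2 (volume.restrict (Ioc 0 T)))
    (hweak : ∀ᵐ t ∂(volume.restrict (Ioc 0 T)), ∃ p, D.WeakEqAt T α u p t) :
    u =ᵐ[volume.restrict (Ioc 0 T)] 0 ∧
      ∀ t ∈ Icc 0 T, (∃ p, D.WeakEqAt T α u p t) → u t = 0 := by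
  obtain ⟨c, hc, hκ⟩ := hD.kappa_elliptic
  have hcoercive := mul_sq_norm_le_kappaForm hD.kappa_bounded hκ
  obtain ⟨M, hM, hB⟩ := exists_norm_B_le hT hα hD
  have hfrac : fracNorm α u =ᵐ[volume.restrict (Ioc 0 T)] 0 := by
    refine ae_fracNorm_eq_zero_of_inner_le hα hT.le
      (by positivity : 0 ≤ M ^ 2 / (4 * c) + M) hu ?_
    filter_upwards [hweak, ae_restrict_mem measurableSet_Ioc] with t ⟨p, hp⟩ ht
    obtain ⟨hB₁, hB₂⟩ := hB u hu t (Ioc_subset_Icc_self ht)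
    exact inner_fracInt_le hc hM ht.1.le (hcoercive p) (hf t) hp hB₁ hB₂
  have hpointwise : ∀ t ∈ Icc 0 T, (∃ p, D.WeakEqAt T α u p t) → fracNorm α u t = 0 →
      u t = 0 := fun t ht ⟨p, hp⟩ hN =>
    eq_zero_of_historyNorm_eq_zero hΩ hc ht.1 (hcoercive p) (hf t) hp (hB u hu t ht).1
      (hB u hu t ht).2 ((historyNorm_eq_fracNorm ht hfrac).trans hN)
  have hae : u =ᵐ[volume.restrict (Ioc 0 T)] 0 := by
    filter_upwards [hweak, hfrac, ae_restrict_mem measurableSet_Ioc] with t hp hN ht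
    exact hpointwise t (Ioc_subset_Icc_self ht) hp hN
  refine ⟨hae, fun t ht hp => hpointwise t ht hp ?_⟩
  rw [fracNorm, fracInt_eq_zero_of_ae_eq_zero hae ht, fracInt_eq_zero_of_ae_eq_zero hae ht,
    norm_zero, add_zero]

end Uniqueness

end FracPDE

theorem theorem4p4_general {d : ℕ} {Ω : Set (FracPDE.E d)} (hΩ : IsOpen Ω) {T : ℝ} (hT : 0 < T)
    {α : ℝ} (hα : α ∈ Ioo (0 : ℝ) 1) {D : FracPDE.Data Ω} (hD : D.WeaklyAdmissible T)
    {u₁ u₂ : ℝ → FracPDE.LpOn Ω ℝ 2} (hu₁ : MemLp u₁ 2 (volume.restrict (Ioo 0 T)))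
    (hu₂ : MemLp u₂ 2 (volume.restrict (Ioo 0 T)))
    (h₁ : ∀ᵐ t ∂(volume.restrict (Ioo 0 T)), ∃ p, D.WeakEqAt T α u₁ p t)
    (h₂ : ∀ᵐ t ∂(volume.restrict (Ioo 0 T)), ∃ p, D.WeakEqAt T α u₂ p t) :
    (∀ᵐ t ∂(volume.restrict (Ioo 0 T)), u₁ t = u₂ t) ∧
    ∀ t ∈ Icc 0 T, (∃ p₁, D.WeakEqAt T α u₁ p₁ t) → (∃ p₂, D.WeakEqAt T α u₂ p₂ t) →
      u₁ t = u₂ t := by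
  rw [Measure.restrict_congr_set Ioo_ae_eq_Ioc] at *
  have hsub : ∀ t ∈ Icc 0 T, (∃ p₁, D.WeakEqAt T α u₁ p₁ t) → (∃ p₂, D.WeakEqAt T α u₂ p₂ t) →
      ∃ p, D.homogeneous.WeakEqAt T α (u₁ - u₂) p t := fun t ht ⟨p₁, hp₁⟩ ⟨p₂, hp₂⟩ =>
    ⟨p₁ - p₂, hp₁.sub hT hα hD hu₁ hu₂ ht hp₂⟩
  obtain ⟨hae, hpointwise⟩ := FracPDE.eq_zero_of_weakEqAt hΩ hT hα hD.homogeneous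
    (FracPDE.homogeneous_f D) (hu₁.sub hu₂) (by
      filter_upwards [h₁, h₂, ae_restrict_mem measurableSet_Ioc] with t hp₁ hp₂ ht
      exact hsub t (Ioc_subset_Icc_self ht) hp₁ hp₂)
  exact ⟨hae.mono fun t ht => sub_eq_zero.1 ht,
    fun t ht hp₁ hp₂ => sub_eq_zero.1 (hpointwise t ht (hsub t ht hp₁ hp₂))⟩

theorem theorem4p4 {d : ℕ} (hd : 1 ≤ d) (Ω : Set (FracPDE.E d)) (hΩ_open : IsOpen Ω)
    (hΩ_bdd : Bornology.IsBounded Ω) (hΩ_lip : FracPDE.HasLipschitzBoundary Ω)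
    (T : ℝ) (hT : 0 < T) (α : ℝ) (hα : α ∈ Set.Ioo (0 : ℝ) 1)
    (D : FracPDE.Data Ω) (hD : D.Admissible T)
    (u₁ u₂ : ℝ → FracPDE.LpOn Ω ℝ 2)
    (h₁ : D.IsWeakSolution T α u₁) (h₂ : D.IsWeakSolution T α u₂) :
    (∀ᵐ t ∂(volume.restrict (Ioo 0 T)), u₁ t = u₂ t) ∧
    ∀ t ∈ Icc 0 T, (∃ p₁, D.WeakEqAt T α u₁ p₁ t) → (∃ p₂, D.WeakEqAt T α u₂ p₂ t) →
      u₁ t = u₂ t := by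
  obtain ⟨P₁, -, hP₁⟩ := h₁.weak
  obtain ⟨P₂, -, hP₂⟩ := h₂.weak
  exact theorem4p4_general hΩ_open hT hα hD.weaklyAdmissible h₁.memLp h₂.memLp
    (hP₁.mono fun t ht => ⟨P₁ t, ht⟩) (hP₂.mono fun t ht => ⟨P₂ t, ht⟩)
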